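/- **Notation.** Let $n\ge 1$. Vectors are columns, $'$ is transposition, $\otimes$ is the Kronecker product, $\mathrm{vec}$ stacks the columns of a matrix, $I_m$ is the $m\times m$ identity matrix, and $K_{n,n}$ is the commutation matrix ($K_{n,n}\mathrm{vec}(A)=\mathrm{vec}(A')$ for every $n\times n$ matrix $A$). A density generator in dimension $m$ is a function $g\ge 0$ on $[0,\infty)$ with $0<\int_0^\infty u^{m/2-1}g(u)\,du<\infty$; $EC_m(\mu,\Sigma,g)$ has density $c_m|\Sigma|^{-1/2}g((x-\mu)'\Sigma^{-1}(x-\mu))$, with $c_m$ the normalizing constant. Let $\mu,\alpha\in\mathbb R^n$, let $\Omega$ be an $n\times n$ positive definite matrix, $\omega=\mathrm{diag}(\Omega)^{1/2}$, $q(x)=(x-\mu)'\Omega^{-1}(x-\mu)$, and let $g=g^{(n+1)}$ be a density generator in dimension $n+1$. The skew-elliptical distribution $SE_n(\mu,\Omega,\alpha,g^{(n+1)})$ has density $$2f_{g^{(n)}}(x;\mu,\Omega)\,F_{g_{q(x)}}\big(\alpha'\omega^{-1}(x-\mu)\big),\quad g^{(n)}(u)=\int_0^\infty r^{-1/2}g^{(n+1)}(r+u)\,dr,\quad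 g_{q}(u)=\frac{g^{(n+1)}(u+q)}{g^{(n)}(q)},$$ where $f_{g^{(n)}}$ is the density of $EC_n(\mu,\Omega,g^{(n)})$ and $F_{g_q}$ is the distribution function of $EC_1(0,1,g_q)$. The skew-normal distribution $SN_n(\mu,\Omega,\alpha)$ is the case $g^{(n+1)}(u)=(2\pi)^{-(n+1)/2}e^{-u/2}$. Let $\delta\in(-1,1)^n$ and the positive definite correlation matrix $\Psi$ be the parameters that correspond to $(\Omega,\alpha)$: with $\Delta=\mathrm{diag}(\sqrt{1-\delta_1^2},\dots,\sqrt{1-\delta_n^2})$ and $\lambda=\Delta^{-1}\delta$, $$\omega^{-1}\Omega\,\omega^{-1}=\Delta(\Psi+\lambda\lambda')\Delta,\qquad \alpha=(1+\lambda'\Psi^{-1}\lambda)^{-1/2}\Delta^{-1}\Psi^{-1}\lambda .$$ Put $\delta_w=\omega\delta$, let $(U_1,U_2')'$ be uniformly distributed on the unit sphere of $\mathbb R^{n+1}$ (with $U_1$ real and $U_2\in\mathbb R^n$), and let $$M=\delta_w|U_1|+\omega\Delta\Psi^{1/2}U_2,$$ with $\Psi^{1/2}$ the positive semidefinite square root.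 **Theorem.** Suppose that $Y\sim SE_n(\mu,\Omega,\alpha,g^{(n+1)})$ has the representation $Y\overset d=R_yM+\mu$, where $R_y\ge 0$ is independent of $(U_1,U_2')'$ and $E(R_y^4)<\infty$. Let $X\sim SN_n(0,\Omega,\alpha)$ have the representation $X\overset d=R_xM$, where $R_x\ge0$ is independent of $(U_1,U_2')'$. Then $E(R_y^k)<\infty$ and $0<E(R_x^k)<\infty$ for $k=1,\dots,4$, the moments below are finite, and $$\begin{aligned} E(Y)&=\mu+\sqrt{\tfrac2\pi}\,\tfrac{E(R_y)}{E(R_x)}\,\delta_w,\\ E(Y\otimes Y')&=\mu\mu'+\sqrt{\tfrac2\pi}\,\tfrac{E(R_y)}{E(R_x)}(\mu\delta_w'+\delta_w\mu')+\tfrac{E(R_y^2)}{E(R_x^2)}\,\Omega,\\ E(Y\otimes Y'\otimes Y)&=\mu\otimes\mu'\otimes\mu+\sqrt{\tfrac2\pi}\,\tfrac{E(R_y)}{E(R_x)}A_1+\tfrac{E(R_y^2)}{E(R_x^2)}A_2+\sqrt{\tfrac2\pi}\,\tfrac{E(R_y^3)}{E(R_x^3)}A_3,\\ E(Y\otimes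 Y'\otimes Y\otimes Y')&=\mu\otimes\mu'\otimes\mu\otimes\mu'+\sqrt{\tfrac2\pi}\,\tfrac{E(R_y)}{E(R_x)}B_1+\tfrac{E(R_y^2)}{E(R_x^2)}B_2+\sqrt{\tfrac2\pi}\,\tfrac{E(R_y^3)}{E(R_x^3)}B_3+\tfrac{E(R_y^4)}{E(R_x^4)}B_4, \end{aligned}$$ where $$\begin{aligned} A_1={}&\delta_w\otimes\mu'\otimes\mu+\mu\otimes\delta_w'\otimes\mu+\mu\otimes\mu'\otimes\delta_w,\\ A_2={}&\Omega\otimes\mu+\mu\otimes\Omega+\mathrm{vec}(\Omega)\otimes\mu',\\ A_3={}&\delta_w\otimes\Omega+\mathrm{vec}(\Omega)\delta_w'+(I_n\otimes\delta_w)\Omega-(I_n\otimes\delta_w)(\delta_w\otimes\delta_w'),\\ B_1={}&\delta_w\otimes\mu'\otimes\mu\otimes\mu'+\mu\otimes\delta_w'\otimes\mu\otimes\mu'+\mu\otimes\mu'\otimes\delta_w\otimes\mu'+\mu\otimes\mu'\otimes\mu\otimes\delta_w',\\ B_2={}&\Omega\otimes\mu\otimes\mu'+\mu\otimes\Omega\otimes\mu'+\mathrm{vec}(\Omega)\otimes\mu'\otimes\mu'+\mu'\otimes\Omega\otimes\mu+\mu\otimes\mu\otimes\mathrm{vec}(\Omega)'+\mu\otimes\mu'\otimes\Omega,\\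 B_3={}&\delta_w\otimes\Omega\otimes\mu'+\mathrm{vec}(\Omega)\otimes\delta_w'\otimes\mu'+((I_n\otimes\delta_w)\Omega)\otimes\mu'+\delta_w'\otimes\Omega\otimes\mu+\delta_w\otimes\mathrm{vec}(\Omega)'\otimes\mu\\ &+(\Omega(I_n\otimes\delta_w'))\otimes\mu+\mu'\otimes\delta_w\otimes\Omega+\mu'\otimes(\mathrm{vec}(\Omega)\delta_w')+\mu'\otimes((I_n\otimes\delta_w)\Omega)+\mu\otimes\delta_w'\otimes\Omega\\ &+\mu\otimes\delta_w\otimes\mathrm{vec}(\Omega)'+\mu\otimes(\Omega(I_n\otimes\delta_w'))-\delta_w\otimes\delta_w'\otimes\delta_w\otimes\mu'-\delta_w'\otimes\delta_w\otimes\delta_w'\otimes\mu\\ &-\mu'\otimes\delta_w\otimes\delta_w'\otimes\delta_w-\mu\otimes\delta_w'\otimes\delta_w\otimes\delta_w',\\ B_4={}&(I_{n^2}+K_{n,n})(\Omega\otimes\Omega)+\mathrm{vec}(\Omega)\,\mathrm{vec}(\Omega)'. \end{aligned}$$ -/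

import Mathlib

noncomputable section

open MeasureTheory ProbabilityTheory Matrix
open scoped Kronecker MatrixOrder Matrix.Norms.L2Operator

namespace SkewElliptical

/-! ### Kronecker algebra with vectors as one-column and one-row matrices

A column vector is a matrix with column index `Unit`, a row vector a matrix with row index `Unit`.
Pairs of indices are ordered lexicographically, as in Mathlib's `⊗ₖ` and `Matrix.vec`. -/

/-- Index set of a Kronecker product, with trivial (one-point) factors deleted. -/
class KronIndex (ι κ : Type*) (τ : outParam Type*) where
  equiv : ι × κ ≃ τ

instance : KronIndex Unit Unit Unit := ⟨Equiv.prodPUnit Unit⟩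

instance (n : ℕ) : KronIndex (Fin n) Unit (Fin n) := ⟨Equiv.prodPUnit (Fin n)⟩

instance (n : ℕ) : KronIndex Unit (Fin n) (Fin n) := ⟨Equiv.punitProd (Fin n)⟩

instance (n : ℕ) : KronIndex (Fin n) (Fin n) (Fin n × Fin n) := ⟨Equiv.refl _⟩

instance (n : ℕ) : KronIndex (Fin n × Fin n) Unit (Fin n × Fin n) := ⟨Equiv.prodPUnit _⟩

instance (n : ℕ) : KronIndex Unit (Fin n × Fin n) (Fin n × Fin n) := ⟨Equiv.punitProd _⟩

/-- The Kronecker product of matrices, with trivial index factors deleted, so that for instance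
`x ⊗ y'` of a column and a row vector of length `n` is an `n × n` matrix. -/
def kron {ι κ ι' κ' τ τ' : Type*} [KronIndex ι ι' τ] [KronIndex κ κ' τ']
    (A : Matrix ι κ ℝ) (B : Matrix ι' κ' ℝ) : Matrix τ τ' ℝ :=
  Matrix.reindex KronIndex.equiv KronIndex.equiv (A ⊗ₖ B)

infixl:75 " ⊠ " => kron

/-- The vector `v` as a column. -/
abbrev col {ι : Type*} (v : ι → ℝ) : Matrix ι Unit ℝ := Matrix.replicateCol Unit v

/-- The vector `v` as a row, `v'`. -/
abbrev row {ι : Type*} (v : ι → ℝ) : Matrix Unit ι ℝ := Matrix.replicateRow Unit v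

/-- `vec A` as a column: the columns of `A` stacked. -/
abbrev vecCol {n : ℕ} (A : Matrix (Fin n) (Fin n) ℝ) : Matrix (Fin n × Fin n) Unit ℝ := col (vec A)

/-- `(vec A)'`. -/
abbrev vecRow {n : ℕ} (A : Matrix (Fin n) (Fin n) ℝ) : Matrix Unit (Fin n × Fin n) ℝ := row (vec A)

/-- The commutation matrix `K_{n,n}`. -/
def commMat (n : ℕ) : Matrix (Fin n × Fin n) (Fin n × Fin n) ℝ :=
  Matrix.of fun p q => if q = p.swap then 1 else 0

/-- `K_{n,n} vec A = vec A'`. -/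
theorem commMat_mulVec_vec {n : ℕ} (A : Matrix (Fin n) (Fin n) ℝ) :
    commMat n *ᵥ vec A = vec Aᵀ := by
  ext p
  simp [commMat, Matrix.mulVec, dotProduct, vec]

/-! ### The coefficient matrices -/

section Coefficients

variable {n : ℕ} (μ δw : Fin n → ℝ) (Om : Matrix (Fin n) (Fin n) ℝ)

def A₁ : Matrix (Fin n × Fin n) (Fin n) ℝ :=
  col δw ⊠ row μ ⊠ col μ + col μ ⊠ row δw ⊠ col μ + col μ ⊠ row μ ⊠ col δw

def A₂ : Matrix (Fin n × Fin n) (Fin n) ℝ :=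
  Om ⊠ col μ + col μ ⊠ Om + vecCol Om ⊠ row μ

def A₃ : Matrix (Fin n × Fin n) (Fin n) ℝ :=
  col δw ⊠ Om + vecCol Om * row δw
    + ((1 : Matrix (Fin n) (Fin n) ℝ) ⊠ col δw) * Om
    - ((1 : Matrix (Fin n) (Fin n) ℝ) ⊠ col δw) * (col δw ⊠ row δw)

def B₁ : Matrix (Fin n × Fin n) (Fin n × Fin n) ℝ :=
  col δw ⊠ row μ ⊠ col μ ⊠ row μ + col μ ⊠ row δw ⊠ col μ ⊠ row μ
    + col μ ⊠ row μ ⊠ col δw ⊠ row μ + col μ ⊠ row μ ⊠ col μ ⊠ row δw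

def B₂ : Matrix (Fin n × Fin n) (Fin n × Fin n) ℝ :=
  Om ⊠ col μ ⊠ row μ + col μ ⊠ Om ⊠ row μ + vecCol Om ⊠ row μ ⊠ row μ
    + row μ ⊠ Om ⊠ col μ + col μ ⊠ col μ ⊠ vecRow Om + col μ ⊠ row μ ⊠ Om

def B₃ : Matrix (Fin n × Fin n) (Fin n × Fin n) ℝ :=
  col δw ⊠ Om ⊠ row μ + vecCol Om ⊠ row δw ⊠ row μ
    + (((1 : Matrix (Fin n) (Fin n) ℝ) ⊠ col δw) * Om) ⊠ row μ
    + row δw ⊠ Om ⊠ col μ + col δw ⊠ vecRow Om ⊠ col μ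
    + (Om * ((1 : Matrix (Fin n) (Fin n) ℝ) ⊠ row δw)) ⊠ col μ
    + row μ ⊠ col δw ⊠ Om + row μ ⊠ (vecCol Om * row δw)
    + row μ ⊠ (((1 : Matrix (Fin n) (Fin n) ℝ) ⊠ col δw) * Om)
    + col μ ⊠ row δw ⊠ Om + col μ ⊠ col δw ⊠ vecRow Om
    + col μ ⊠ (Om * ((1 : Matrix (Fin n) (Fin n) ℝ) ⊠ row δw))
    - col δw ⊠ row δw ⊠ col δw ⊠ row μ - row δw ⊠ col δw ⊠ row δw ⊠ col μ
    - row μ ⊠ col δw ⊠ row δw ⊠ col δw - col μ ⊠ row δw ⊠ col δw ⊠ row δw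

def B₄ : Matrix (Fin n × Fin n) (Fin n × Fin n) ℝ :=
  (1 + commMat n) * (Om ⊠ Om) + vecCol Om * vecRow Om

end Coefficients

/-! ### Elliptical and skew-elliptical distributions -/

/-- `g` is a density generator in dimension `m`. -/
structure IsDensityGenerator (m : ℕ) (g : ℝ → ℝ) : Prop where
  nonneg : ∀ u, 0 ≤ u → 0 ≤ g u
  integrable : IntegrableOn (fun u => u ^ ((m : ℝ) / 2 - 1) * g u) (Set.Ioi 0)
  pos : 0 < ∫ u in Set.Ioi (0 : ℝ), u ^ ((m : ℝ) / 2 - 1) * g u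

/-- The normalizing constant `c_m` of the `m`-dimensional elliptical density with generator `g`. -/
def normConst (m : ℕ) (g : ℝ → ℝ) : ℝ :=
  Real.Gamma ((m : ℝ) / 2)
    / (Real.pi ^ ((m : ℝ) / 2) * ∫ u in Set.Ioi (0 : ℝ), u ^ ((m : ℝ) / 2 - 1) * g u)

/-- The quadratic form `q(x) = (x - μ)' Σ⁻¹ (x - μ)`. -/
def quadForm {m : ℕ} (μ : Fin m → ℝ) (S : Matrix (Fin m) (Fin m) ℝ) (x : Fin m → ℝ) : ℝ :=
  (x - μ) ⬝ᵥ (S⁻¹ *ᵥ (x - μ))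

/-- The density of `EC_m(μ, Σ, g)`. -/
def ecDensity {m : ℕ} (μ : Fin m → ℝ) (S : Matrix (Fin m) (Fin m) ℝ) (g : ℝ → ℝ)
    (x : Fin m → ℝ) : ℝ :=
  normConst m g * (√S.det)⁻¹ * g (quadForm μ S x)

/-- The cumulative distribution function of `EC_1(0, 1, g)`. -/
def ecCdf (g : ℝ → ℝ) (t : ℝ) : ℝ :=
  ∫ s in Set.Iic t, ecDensity (0 : Fin 1 → ℝ) 1 g (fun _ => s)

/-- The marginal generator `g^{(n)}` of `g^{(n+1)} = g`. -/
def margGen (g : ℝ → ℝ) (u : ℝ) : ℝ :=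
  ∫ r in Set.Ioi (0 : ℝ), r ^ (-(1 / 2) : ℝ) * g (r + u)

/-- The conditional generator `g_q` of `g^{(n+1)} = g`. -/
def condGen (g : ℝ → ℝ) (q u : ℝ) : ℝ := g (u + q) / margGen g q

/-- The scale matrix `ω = diag(Ω)^{1/2}`. -/
def scaleMat {n : ℕ} (Om : Matrix (Fin n) (Fin n) ℝ) : Matrix (Fin n) (Fin n) ℝ :=
  Matrix.diagonal fun i => √(Om i i)

/-- The density of `SE_n(μ, Ω, α, g)`, where `g = g^{(n+1)}`. -/
def seDensity {n : ℕ} (μ : Fin n → ℝ) (Om : Matrix (Fin n) (Fin n) ℝ) (α : Fin n → ℝ)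
    (g : ℝ → ℝ) (x : Fin n → ℝ) : ℝ :=
  2 * ecDensity μ Om (margGen g) x
    * ecCdf (condGen g (quadForm μ Om x)) (α ⬝ᵥ ((scaleMat Om)⁻¹ *ᵥ (x - μ)))

/-- The distribution `SE_n(μ, Ω, α, g)` on `ℝⁿ`. -/
def skewElliptical {n : ℕ} (μ : Fin n → ℝ) (Om : Matrix (Fin n) (Fin n) ℝ) (α : Fin n → ℝ)
    (g : ℝ → ℝ) : Measure (Fin n → ℝ) :=
  volume.withDensity fun x => ENNReal.ofReal (seDensity μ Om α g x)

/-- The normal density generator in dimension `m`. -/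
def normalGen (m : ℕ) (u : ℝ) : ℝ :=
  (2 * Real.pi) ^ (-((m : ℝ) / 2)) * Real.exp (-u / 2)

/-- The skew-normal distribution `SN_n(μ, Ω, α)`. -/
def skewNormal {n : ℕ} (μ : Fin n → ℝ) (Om : Matrix (Fin n) (Fin n) ℝ) (α : Fin n → ℝ) :
    Measure (Fin n → ℝ) :=
  skewElliptical μ Om α (normalGen (n + 1))

/-- The matrix `Δ = diag((1 - δ₁²)^{1/2}, …, (1 - δₙ²)^{1/2})`. -/
def deltaMat {n : ℕ} (δ : Fin n → ℝ) : Matrix (Fin n) (Fin n) ℝ :=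
  Matrix.diagonal fun i => √(1 - δ i ^ 2)

/-- The pair `(δ, Ψ)` of the additive construction that corresponds to `(Ω, α)`:
`Ψ` is a full rank correlation matrix, `δ ∈ (-1, 1)ⁿ` and, with `λ = Δ⁻¹ δ`,
`ω⁻¹ Ω ω⁻¹ = Δ (Ψ + λ λ') Δ` and `α = (1 + λ' Ψ⁻¹ λ)^{-1/2} Δ⁻¹ Ψ⁻¹ λ`. -/
structure IsAdditiveParam {n : ℕ} (Om : Matrix (Fin n) (Fin n) ℝ) (α δ : Fin n → ℝ)
    (Psi : Matrix (Fin n) (Fin n) ℝ) : Prop where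
  posDef : Psi.PosDef
  diag : ∀ i, Psi i i = 1
  mem : ∀ i, δ i ∈ Set.Ioo (-1 : ℝ) 1
  corr : (scaleMat Om)⁻¹ * Om * (scaleMat Om)⁻¹ =
    deltaMat δ * (Psi + vecMulVec ((deltaMat δ)⁻¹ *ᵥ δ) ((deltaMat δ)⁻¹ *ᵥ δ)) * deltaMat δ
  shape : α = (√(1 + ((deltaMat δ)⁻¹ *ᵥ δ) ⬝ᵥ (Psi⁻¹ *ᵥ ((deltaMat δ)⁻¹ *ᵥ δ))))⁻¹ •
    ((deltaMat δ)⁻¹ *ᵥ (Psi⁻¹ *ᵥ ((deltaMat δ)⁻¹ *ᵥ δ)))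

/-- The uniform distribution on the unit sphere of `ℝᵐ`, as a measure on `ℝᵐ`:
normalized surface measure. -/
def sphereUniform (m : ℕ) : Measure (EuclideanSpace ℝ (Fin m)) :=
  (((volume : Measure (EuclideanSpace ℝ (Fin m))).toSphere Set.univ)⁻¹ •
    (volume : Measure (EuclideanSpace ℝ (Fin m))).toSphere).map Subtype.val

/-- `δ_w = ω δ`. -/
def scaledDelta {n : ℕ} (Om : Matrix (Fin n) (Fin n) ℝ) (δ : Fin n → ℝ) : Fin n → ℝ :=
  scaleMat Om *ᵥ δ

/-- `M = δ_w |U₁| + ω Δ Ψ^{1/2} U₂` for `u = (U₁, U₂')'`; here `CFC.sqrt Ψ` is the positive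
semidefinite square root. -/
def repM {n : ℕ} (Om : Matrix (Fin n) (Fin n) ℝ) (δ : Fin n → ℝ)
    (Psi : Matrix (Fin n) (Fin n) ℝ) (u : EuclideanSpace ℝ (Fin (n + 1))) : Fin n → ℝ :=
  |u 0| • scaledDelta Om δ + (scaleMat Om * deltaMat δ * CFC.sqrt Psi) *ᵥ (fun i => u i.succ)

/-! ### Moments -/

/-- The entrywise expectation of a random matrix. -/
def expMat {S ι κ : Type*} [MeasurableSpace S] (P : Measure S) (Z : S → Matrix ι κ ℝ) :
    Matrix ι κ ℝ :=
  Matrix.of fun i j => ∫ s, Z s i j ∂P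

/-- All entries of the random matrix `Z` are integrable. -/
def MatIntegrable {S ι κ : Type*} [MeasurableSpace S] (P : Measure S) (Z : S → Matrix ι κ ℝ) :
    Prop :=
  ∀ i j, Integrable (fun s => Z s i j) P

end SkewElliptical

end

open MeasureTheory ProbabilityTheory SkewElliptical

open MeasureTheory ProbabilityTheory SkewElliptical

namespace SkewElliptical

open scoped Matrix

/-! Products of coordinates of `R_y M + μ` multiply out into terms homogeneous in `M`, of degree at
most four. The radius is independent of the direction, so `E(R^k F(M)) = E(R^k) E(F(M))` for `F`
homogeneous of degree `k`. The factor `E(F(M))` does not involve the generator, and the skew-normal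
vector `X = R_x M` determines it: `E(F(M)) = E(F(X)) / E(R_x^k)`. Hence each homogeneous term has
its skew-normal mean multiplied by `E(R_y^k) / E(R_x^k)` (`hasMean_homogeneous`). The division is
legitimate because `X` has all moments and its coordinates are not almost surely zero
(`integrable_radial_pow`).

What remains are the skew-normal moments up to order four. The skew-normal law is that of a normal
vector `Z` with covariance `Ω`, conditioned on `V ≥ 0` for a standard normal `V` jointly Gaussian
with `Z` (`skewNormal_eq_map`). A linear functional `T = t'Z` splits as `T = d V + N` with `d =
Cov(T, V)` and `N` independent of `V`, so its conditional moments reduce to half-line Gaussian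
moments (`integral_pow_restrict_nonneg`, `skewNormal_moments`). The algebra of the additive
parameters gives `Cov(Z, V) = δ_w` (`IsAdditiveParam.mulVec_eq`), and polarization passes from
powers of linear functionals to mixed moments (`hasMean_skewNormal`). The matrix formulas are then
compared entry by entry. -/

/-! ### The normal density generator. -/

theorem margGen_normalGen (n : ℕ) (u : ℝ) : margGen (normalGen (n + 1)) u = normalGen n u := by
  have h := Real.integral_rpow_mul_exp_neg_mul_Ioi (a := 1 / 2) (r := 1 / 2) (by norm_num)
    (by norm_num)
  have e : ∀ r : ℝ, r ^ (-(1 / 2) : ℝ) * normalGen (n + 1) (r + u)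
      = ((2 * Real.pi) ^ (-(((n + 1 : ℕ) : ℝ) / 2)) * Real.exp (-u / 2))
        * (r ^ ((1 : ℝ) / 2 - 1) * Real.exp (-(1 / 2 * r))) := by
    intro r
    have : Real.exp (-(r + u) / 2) = Real.exp (-u / 2) * Real.exp (-(1 / 2 * r)) := by
      rw [← Real.exp_add]; congr 1; ring
    rw [normalGen, this]
    norm_num
    ring
  unfold margGen
  simp_rw [e]
  rw [integral_const_mul, h, Real.Gamma_one_half_eq]
  have h2 : (2 * Real.pi) ^ (-(((n + 1 : ℕ) : ℝ) / 2))
      = (2 * Real.pi) ^ (-((n : ℝ) / 2)) * (2 * Real.pi) ^ (-(1 / 2) : ℝ) := by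
    rw [← Real.rpow_add (by positivity)]; congr 1; push_cast; ring
  have h3 : (2 * Real.pi) ^ (-(1 / 2) : ℝ) * ((1 / (1 / 2)) ^ (1 / 2 : ℝ) * √Real.pi) = 1 := by
    rw [Real.sqrt_eq_rpow, ← Real.mul_rpow (by norm_num) Real.pi_pos.le,
      Real.rpow_neg (by positivity)]
    norm_num
    exact inv_mul_cancel₀ (by positivity)
  rw [h2, normalGen]
  linear_combination ((2 * Real.pi) ^ (-((n : ℝ) / 2)) * Real.exp (-u / 2)) * h3

theorem normConst_normalGen {n : ℕ} (hn : 1 ≤ n) : normConst n (normalGen n) = 1 := by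
  have hn' : (0 : ℝ) < (n : ℝ) / 2 := by
    have : (1 : ℝ) ≤ n := by exact_mod_cast hn
    linarith
  have h := Real.integral_rpow_mul_exp_neg_mul_Ioi (a := (n : ℝ) / 2) (r := 1 / 2) hn'
    (by norm_num)
  have e : ∀ u : ℝ, u ^ ((n : ℝ) / 2 - 1) * normalGen n u
      = (2 * Real.pi) ^ (-((n : ℝ) / 2)) * (u ^ ((n : ℝ) / 2 - 1) * Real.exp (-(1 / 2 * u))) := by
    intro u
    rw [normalGen, show -u / 2 = -(1 / 2 * u) by ring]
    ring
  have hG := (Real.Gamma_pos_of_pos hn').ne'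
  unfold normConst
  simp_rw [e]
  rw [integral_const_mul, h, Real.rpow_neg (by positivity),
    Real.mul_rpow (by norm_num) Real.pi_pos.le, show (1 : ℝ) / (1 / 2) = 2 by norm_num]
  have h1 : (0 : ℝ) < 2 ^ ((n : ℝ) / 2) := by positivity
  have h2 : (0 : ℝ) < Real.pi ^ ((n : ℝ) / 2) := Real.rpow_pos_of_pos Real.pi_pos _
  field_simp

/-- The exponential factorizes, so conditioning leaves no trace of `q`; this is what makes the
skewing factor of the skew-normal density a fixed distribution function. -/
theorem condGen_normalGen (n : ℕ) (q : ℝ) : condGen (normalGen (n + 1)) q = normalGen 1 := by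
  funext u
  rw [condGen, margGen_normalGen, normalGen, normalGen, normalGen]
  have h2 : (2 * Real.pi) ^ (-(((n + 1 : ℕ) : ℝ) / 2))
      = (2 * Real.pi) ^ (-((n : ℝ) / 2)) * (2 * Real.pi) ^ (-(((1 : ℕ) : ℝ) / 2)) := by
    rw [← Real.rpow_add (by positivity)]; congr 1; push_cast; ring
  have h3 : Real.exp (-(u + q) / 2) = Real.exp (-u / 2) * Real.exp (-q / 2) := by
    rw [← Real.exp_add]; congr 1; ring
  have h4 : (0 : ℝ) < (2 * Real.pi) ^ (-((n : ℝ) / 2)) := by positivity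
  rw [h2, h3]
  field_simp

theorem ecDensity_one_normalGen (s : ℝ) :
    ecDensity (0 : Fin 1 → ℝ) 1 (normalGen 1) (fun _ => s) = gaussianPDFReal 0 1 s := by
  rw [ecDensity, normConst_normalGen le_rfl, gaussianPDFReal, normalGen, quadForm]
  simp only [Matrix.det_one, inv_one, sub_zero, Matrix.one_mulVec, dotProduct,
    NNReal.coe_one, mul_one, one_mul, Finset.univ_unique, Finset.sum_singleton, Nat.cast_one,
    Real.sqrt_eq_rpow, Real.one_rpow]
  rw [Real.rpow_neg (by positivity), sq]

theorem ecCdf_normalGen (t : ℝ) :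
    ENNReal.ofReal (ecCdf (normalGen 1) t) = gaussianReal 0 1 (Set.Iic t) := by
  rw [ecCdf, gaussianReal_apply_eq_integral 0 one_ne_zero]
  simp_rw [ecDensity_one_normalGen]

/-! ### The skew-normal law as a conditioned normal law. -/

/-- The standard normal distribution on `ℝⁿ`. -/
noncomputable def stdNormal (n : ℕ) : Measure (Fin n → ℝ) :=
  Measure.pi fun _ => gaussianReal 0 1

instance (n : ℕ) : IsProbabilityMeasure (stdNormal n) := by unfold stdNormal; infer_instance

theorem stdNormal_eq_withDensity (n : ℕ) :
    stdNormal n = volume.withDensity fun z => ENNReal.ofReal (normalGen n (z ⬝ᵥ z)) := by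
  have hp : ∀ z : Fin n → ℝ, normalGen n (z ⬝ᵥ z) = ∏ i, gaussianPDFReal 0 1 (z i) := by
    intro z
    simp only [gaussianPDFReal, Finset.prod_mul_distrib, ← Real.exp_sum, normalGen, dotProduct]
    congr 1
    · simp only [Finset.prod_const, Finset.card_univ, Fintype.card_fin, NNReal.coe_one, mul_one]
      rw [Real.sqrt_eq_rpow, ← Real.rpow_neg (by positivity),
        ← Real.rpow_mul_natCast (by positivity)]
      congr 1; ring
    · simp only [sub_zero, NNReal.coe_one, mul_one, neg_div, Finset.sum_neg_distrib,
        Finset.sum_div, sq]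
  unfold stdNormal
  refine Measure.pi_eq fun s hs => ?_
  rw [withDensity_apply _ (MeasurableSet.univ_pi hs),
    ← lintegral_indicator (MeasurableSet.univ_pi hs)]
  -- The indicator of a box is absorbed coordinatewise, leaving a product integrand to which Fubini
  -- applies.
  have hi : ∀ z : Fin n → ℝ, (Set.univ.pi s).indicator
      (fun z => ENNReal.ofReal (normalGen n (z ⬝ᵥ z))) z
      = ENNReal.ofReal (∏ i, (s i).indicator (gaussianPDFReal 0 1) (z i)) := by
    intro z
    by_cases hz : z ∈ Set.univ.pi s
    · rw [Set.indicator_of_mem hz, hp]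
      congr 1
      exact Finset.prod_congr rfl fun i _ => (Set.indicator_of_mem (hz i trivial) _).symm
    · rw [Set.indicator_of_notMem hz]
      obtain ⟨i, hi⟩ : ∃ i, z i ∉ s i := by simpa [Set.mem_pi] using hz
      rw [Finset.prod_eq_zero (Finset.mem_univ i) (Set.indicator_of_notMem hi _),
        ENNReal.ofReal_zero]
  have hint : ∀ i, Integrable ((s i).indicator (gaussianPDFReal 0 1)) :=
    fun i => (integrable_gaussianPDFReal 0 1).indicator (hs i)
  have hnn : ∀ i x, 0 ≤ (s i).indicator (gaussianPDFReal 0 1) x :=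
    fun i x => Set.indicator_nonneg (fun y _ => gaussianPDFReal_nonneg 0 1 y) x
  simp_rw [hi]
  rw [← ofReal_integral_eq_lintegral_ofReal, volume_pi,
    integral_fintype_prod_eq_prod (𝕜 := ℝ) (fun i => (s i).indicator (gaussianPDFReal 0 1)),
    ENNReal.ofReal_prod_of_nonneg]
  · refine Finset.prod_congr rfl fun i _ => ?_
    rw [gaussianReal_apply_eq_integral 0 one_ne_zero, integral_indicator (hs i)]
  · exact fun i _ => integral_nonneg (hnn i)
  · rw [volume_pi]
    exact Integrable.fintype_prod (𝕜 := ℝ) hint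
  · exact Filter.Eventually.of_forall fun z => Finset.prod_nonneg fun i _ => hnn i _

open scoped MatrixOrder Matrix.Norms.L2Operator in
theorem exists_mul_transpose_eq {n : ℕ} {Om : Matrix (Fin n) (Fin n) ℝ} (hOm : Om.PosDef) :
    ∃ S : Matrix (Fin n) (Fin n) ℝ, S.det ≠ 0 ∧ S * Sᵀ = Om := by
  obtain ⟨B, hB⟩ := CStarAlgebra.nonneg_iff_eq_star_mul_self.mp hOm.posSemidef.nonneg
  have hB' : Bᵀ * B = Om := by
    rw [hB, Matrix.star_eq_conjTranspose, Matrix.conjTranspose_eq_transpose_of_trivial]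
  refine ⟨Bᵀ, fun h => hOm.det_pos.ne' ?_, by simpa using hB'⟩
  rw [← hB', Matrix.det_mul, h, zero_mul]

/-- Change of variables `x = S z`: the quadratic form of `(S S')⁻¹` at `S z` is `z'z`, and the
Jacobian `|det S|⁻¹` is the determinant factor of the elliptical density. -/
theorem map_mulVec_stdNormal {n : ℕ} (hn : 1 ≤ n) {S : Matrix (Fin n) (Fin n) ℝ}
    (hS : S.det ≠ 0) :
    (stdNormal n).map (S *ᵥ ·) = volume.withDensity fun x =>
      ENNReal.ofReal (ecDensity 0 (S * Sᵀ) (normalGen n) x) := by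
  have hm : Measurable fun z : Fin n → ℝ => S *ᵥ z := by fun_prop
  have hN : Measurable (normalGen n) := by unfold normalGen; fun_prop
  have hdet : √(S * Sᵀ).det = |S.det| := by
    rw [Matrix.det_mul, Matrix.det_transpose, Real.sqrt_mul_self_eq_abs]
  have hq : ∀ z, quadForm 0 (S * Sᵀ) (S *ᵥ z) = z ⬝ᵥ z := by
    intro z
    rw [quadForm, sub_zero, Matrix.mul_inv_rev, ← Matrix.mulVec_mulVec, Matrix.mulVec_mulVec _ S⁻¹,
      Matrix.nonsing_inv_mul _ (isUnit_iff_ne_zero.mpr hS), Matrix.one_mulVec,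
      Matrix.dotProduct_mulVec, ← Matrix.mulVec_transpose, Matrix.mulVec_mulVec,
      ← Matrix.transpose_nonsing_inv, Matrix.transpose_transpose,
      Matrix.nonsing_inv_mul _ (isUnit_iff_ne_zero.mpr hS), Matrix.one_mulVec]
  have hqm : Measurable fun x => ENNReal.ofReal (normalGen n (quadForm 0 (S * Sᵀ) x)) := by
    unfold quadForm
    refine (hN.comp ?_).ennreal_ofReal
    simp only [dotProduct, Matrix.mulVec]
    fun_prop
  ext A hA
  rw [Measure.map_apply hm hA, stdNormal_eq_withDensity, withDensity_apply _ (hm hA),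
    withDensity_apply _ hA]
  have h1 : ∀ x, ENNReal.ofReal (ecDensity 0 (S * Sᵀ) (normalGen n) x)
      = ENNReal.ofReal |S.det|⁻¹ * ENNReal.ofReal (normalGen n (quadForm 0 (S * Sᵀ) x)) := by
    intro x
    rw [ecDensity, normConst_normalGen hn, one_mul, hdet, ENNReal.ofReal_mul (by positivity)]
  simp_rw [h1]
  have hv := Real.map_matrix_volume_pi_eq_smul_volume_pi hS
  rw [lintegral_const_mul _ hqm, ← lintegral_indicator hA]
  have h2 : ENNReal.ofReal |S.det|⁻¹ * ∫⁻ x, A.indicator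
      (fun x => ENNReal.ofReal (normalGen n (quadForm 0 (S * Sᵀ) x))) x
      = ∫⁻ x, A.indicator (fun x => ENNReal.ofReal (normalGen n (quadForm 0 (S * Sᵀ) x))) x
          ∂(volume.map (Matrix.toLin' S)) := by
    rw [hv, lintegral_smul_measure, abs_inv, smul_eq_mul]
  have hm' : Measurable (Matrix.toLin' S) := hm
  rw [h2, lintegral_map (hqm.indicator hA) (hm'),
    ← lintegral_indicator (hm hA)]
  refine lintegral_congr fun z => ?_
  simp only [Set.indicator, Matrix.toLin'_apply, hq]
  rfl

/-- The skew-normal law is the law of a normal vector conditioned on a linear inequality. -/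
theorem skewNormal_eq_map {n : ℕ} (hn : 1 ≤ n) (α : Fin n → ℝ) {S : Matrix (Fin n) (Fin n) ℝ}
    (hS : S.det ≠ 0) :
    skewNormal 0 (S * Sᵀ) α = (2 : ENNReal) •
      (((stdNormal n).prod (gaussianReal 0 1)).restrict
        {p | p.2 ≤ α ⬝ᵥ ((scaleMat (S * Sᵀ))⁻¹ *ᵥ (S *ᵥ p.1))}).map (fun p => S *ᵥ p.1) := by
  have hm : Measurable fun z : Fin n → ℝ => S *ᵥ z := by fun_prop
  have hl : Measurable fun x : Fin n → ℝ => α ⬝ᵥ ((scaleMat (S * Sᵀ))⁻¹ *ᵥ x) := by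
    simp only [dotProduct, Matrix.mulVec]; fun_prop
  have hΦ : Measurable fun t : ℝ => gaussianReal 0 1 (Set.Iic t) :=
    Monotone.measurable fun a b hab => measure_mono (Set.Iic_subset_Iic.mpr hab)
  have hset : MeasurableSet {p : (Fin n → ℝ) × ℝ |
      p.2 ≤ α ⬝ᵥ ((scaleMat (S * Sᵀ))⁻¹ *ᵥ (S *ᵥ p.1))} :=
    measurableSet_le measurable_snd (hl.comp (hm.comp measurable_fst))
  -- The density is twice a normal density times the standard normal mass of a half-line. Fubini
  -- reads that mass as an extra independent normal coordinate lying below the threshold.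
  have hd : ∀ x, ENNReal.ofReal (seDensity 0 (S * Sᵀ) α (normalGen (n + 1)) x)
      = 2 * (ENNReal.ofReal (ecDensity 0 (S * Sᵀ) (normalGen n) x)
        * gaussianReal 0 1 (Set.Iic (α ⬝ᵥ ((scaleMat (S * Sᵀ))⁻¹ *ᵥ x)))) := by
    intro x
    have hM : margGen (normalGen (n + 1)) = normalGen n := funext (margGen_normalGen n)
    have hnn : 0 ≤ ecDensity 0 (S * Sᵀ) (normalGen n) x := by
      rw [ecDensity, normConst_normalGen hn, normalGen]; positivity
    rw [seDensity, hM, condGen_normalGen, sub_zero, ENNReal.ofReal_mul (by positivity),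
      ENNReal.ofReal_mul (by norm_num), ecCdf_normalGen]
    norm_num [mul_assoc]
  have hem : Measurable fun x => ENNReal.ofReal (ecDensity 0 (S * Sᵀ) (normalGen n) x) := by
    unfold ecDensity quadForm normalGen
    simp only [dotProduct, Matrix.mulVec]
    fun_prop
  have hm1 : Measurable fun p : (Fin n → ℝ) × ℝ => S *ᵥ p.1 := hm.comp measurable_fst
  have hΦl : Measurable fun x =>
      gaussianReal 0 1 (Set.Iic (α ⬝ᵥ ((scaleMat (S * Sᵀ))⁻¹ *ᵥ x))) := hΦ.comp hl
  ext A hA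
  rw [Measure.smul_apply, smul_eq_mul,
    Measure.map_apply hm1 hA, Measure.restrict_apply (hm1 hA),
    Measure.prod_apply ((hm1 hA).inter hset), skewNormal, skewElliptical, withDensity_apply _ hA]
  simp_rw [hd]
  rw [lintegral_const_mul' _ _ (by simp)]
  congr 1
  have h1 : ∫⁻ x in A, ENNReal.ofReal (ecDensity 0 (S * Sᵀ) (normalGen n) x)
        * gaussianReal 0 1 (Set.Iic (α ⬝ᵥ ((scaleMat (S * Sᵀ))⁻¹ *ᵥ x)))
      = ∫⁻ x in A, gaussianReal 0 1 (Set.Iic (α ⬝ᵥ ((scaleMat (S * Sᵀ))⁻¹ *ᵥ x)))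
          ∂((stdNormal n).map (S *ᵥ ·)) := by
    rw [map_mulVec_stdNormal hn hS]
    exact (setLIntegral_withDensity_eq_setLIntegral_mul _ hem hΦl hA).symm
  rw [h1, setLIntegral_map hA hΦl hm, ← lintegral_indicator (hm hA)]
  refine lintegral_congr fun z => ?_
  by_cases hz : S *ᵥ z ∈ A
  · rw [Set.indicator_of_mem (by exact hz)]
    congr 1
    ext w
    simp [hz]
  · rw [Set.indicator_of_notMem (by exact hz)]
    symm
    convert measure_empty
    · ext w; simp [hz]
    · infer_instance

/-! ### Gaussian moments on a half-line and on a half-space. -/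

theorem gaussianReal_integrable_pow (k : ℕ) (v : NNReal) :
    Integrable (fun x : ℝ => x ^ k) (gaussianReal 0 v) :=
  (memLp_id_gaussianReal' (k : ENNReal) (by simp)).integrable_norm_pow' |>.mono
    (by fun_prop) (by simp)

theorem integral_Ici_pow_gaussianReal (k : ℕ) :
    ∫ x in Set.Ici (0 : ℝ), x ^ k ∂gaussianReal 0 1
      = (√(2 * Real.pi))⁻¹ * ((1 / 2 : ℝ) ^ (-((k : ℝ) + 1) / 2) * (1 / 2)
        * Real.Gamma (((k : ℝ) + 1) / 2)) := by
  have h := integral_rpow_mul_exp_neg_mul_rpow (p := 2) (q := (k : ℝ)) (b := 1 / 2) (by norm_num)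
    (by have : (0 : ℝ) ≤ k := Nat.cast_nonneg k
        linarith) (by norm_num)
  rw [← integral_indicator measurableSet_Ici,
    integral_gaussianReal_eq_integral_smul one_ne_zero]
  have e : ∀ x : ℝ, gaussianPDFReal 0 1 x • (Set.Ici (0 : ℝ)).indicator (fun x => x ^ k) x
      = (Set.Ici (0 : ℝ)).indicator (fun x => (√(2 * Real.pi))⁻¹ *
        (x ^ (k : ℝ) * Real.exp (-(1 / 2) * x ^ (2 : ℝ)))) x := by
    intro x
    by_cases hx : x ∈ Set.Ici (0 : ℝ)
    · rw [Set.indicator_of_mem hx, Set.indicator_of_mem hx, gaussianPDFReal, Real.rpow_natCast,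
        Real.rpow_two, sub_zero, NNReal.coe_one, smul_eq_mul]
      rw [show -x ^ 2 / (2 * 1) = -(1 / 2) * x ^ 2 by ring, mul_one]
      ring
    · rw [Set.indicator_of_notMem hx, Set.indicator_of_notMem hx, smul_zero]
  simp_rw [e]
  rw [integral_indicator measurableSet_Ici, integral_Ici_eq_integral_Ioi, integral_const_mul, h]

theorem integral_Ici_gaussianReal_zero :
    ∫ x in Set.Ici (0 : ℝ), x ^ 0 ∂gaussianReal 0 1 = 1 / 2 := by
  rw [integral_Ici_pow_gaussianReal, Real.sqrt_mul (by norm_num)]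
  have h2 : (1 / 2 : ℝ) ^ (-(((0 : ℕ) : ℝ) + 1) / 2) = √2 := by
    rw [one_div, Real.inv_rpow (by norm_num), ← Real.rpow_neg (by norm_num), Real.sqrt_eq_rpow]
    norm_num
  rw [h2]
  norm_num [Real.Gamma_one_half_eq]
  field_simp

theorem integral_Ici_gaussianReal_one :
    ∫ x in Set.Ici (0 : ℝ), x ^ 1 ∂gaussianReal 0 1 = (√(2 * Real.pi))⁻¹ := by
  rw [integral_Ici_pow_gaussianReal]
  norm_num [Real.rpow_neg_one]

theorem Gamma_three_halves : Real.Gamma (3 / 2) = √Real.pi / 2 := by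
  rw [show (3 / 2 : ℝ) = 1 / 2 + 1 by norm_num, Real.Gamma_add_one (by norm_num),
    Real.Gamma_one_half_eq]
  ring

theorem integral_Ici_gaussianReal_two :
    ∫ x in Set.Ici (0 : ℝ), x ^ 2 ∂gaussianReal 0 1 = 1 / 2 := by
  rw [integral_Ici_pow_gaussianReal, Real.sqrt_mul (by norm_num)]
  have h2 : (1 / 2 : ℝ) ^ (-(((2 : ℕ) : ℝ) + 1) / 2) = 2 * √2 := by
    rw [one_div, Real.inv_rpow (by norm_num), ← Real.rpow_neg (by norm_num), Real.sqrt_eq_rpow,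
      ← Real.rpow_one_add' (by norm_num) (by norm_num)]
    norm_num
  rw [h2]
  norm_num [Gamma_three_halves]
  field_simp

theorem integral_Ici_gaussianReal_three :
    ∫ x in Set.Ici (0 : ℝ), x ^ 3 ∂gaussianReal 0 1 = 2 * (√(2 * Real.pi))⁻¹ := by
  rw [integral_Ici_pow_gaussianReal]
  have h2 : (1 / 2 : ℝ) ^ (-(((3 : ℕ) : ℝ) + 1) / 2) = 4 := by
    rw [show (-(((3 : ℕ) : ℝ) + 1) / 2) = ((-2 : ℤ) : ℝ) by norm_num, Real.rpow_intCast]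
    norm_num
  have h3 : Real.Gamma ((((3 : ℕ) : ℝ) + 1) / 2) = 1 := by
    rw [show (((3 : ℕ) : ℝ) + 1) / 2 = 2 by norm_num, Real.Gamma_two]
  rw [h2, h3]
  ring

theorem integral_Ici_gaussianReal_four :
    ∫ x in Set.Ici (0 : ℝ), x ^ 4 ∂gaussianReal 0 1 = 3 / 2 := by
  rw [integral_Ici_pow_gaussianReal, Real.sqrt_mul (by norm_num)]
  have h2 : (1 / 2 : ℝ) ^ (-(((4 : ℕ) : ℝ) + 1) / 2) = 4 * √2 := by
    rw [one_div, Real.inv_rpow (by norm_num), ← Real.rpow_neg (by norm_num), Real.sqrt_eq_rpow,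
      show (4 : ℝ) = 2 ^ (2 : ℝ) by norm_num, ← Real.rpow_add (by norm_num)]
    norm_num
  have h3 : Real.Gamma ((((4 : ℕ) : ℝ) + 1) / 2) = 3 / 4 * √Real.pi := by
    rw [show (((4 : ℕ) : ℝ) + 1) / 2 = 3 / 2 + 1 by norm_num, Real.Gamma_add_one (by norm_num),
      Gamma_three_halves]
    ring
  rw [h2, h3]
  field_simp

/-- The reflection `x ↦ -x` preserves the law and multiplies `x ^ k` by `(-1) ^ k`; odd moments
cancel and even ones double. -/
theorem integral_pow_gaussianReal_eq_Ici (k : ℕ) :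
    ∫ x, x ^ k ∂gaussianReal 0 1
      = (1 + (-1) ^ k) * ∫ x in Set.Ici (0 : ℝ), x ^ k ∂gaussianReal 0 1 := by
  have : NullSingletonClass (gaussianReal 0 1) := nullSingletonClass_gaussianReal one_ne_zero
  have hneg : ∫ x in Set.Iio (0 : ℝ), x ^ k ∂gaussianReal 0 1
      = (-1) ^ k * ∫ x in Set.Ici (0 : ℝ), x ^ k ∂gaussianReal 0 1 := by
    have hmap : (gaussianReal 0 1).map (fun x : ℝ => -x) = gaussianReal 0 1 := by
      rw [gaussianReal_map_neg, neg_zero]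
    conv_lhs => rw [← hmap]
    rw [setIntegral_map measurableSet_Iio (by fun_prop) (by fun_prop), integral_Ici_eq_integral_Ioi,
      ← integral_const_mul]
    have : (fun x : ℝ => -x) ⁻¹' Set.Iio 0 = Set.Ioi 0 := by ext; simp
    rw [this]
    exact integral_congr_ae (Filter.Eventually.of_forall fun x => by simp only; rw [neg_pow])
  rw [← integral_add_compl measurableSet_Ici (gaussianReal_integrable_pow k 1), Set.compl_Ici, hneg]
  ring

theorem integral_pow_gaussianReal (k : ℕ) (v : NNReal) :
    ∫ x, x ^ k ∂gaussianReal 0 v = √v ^ k * ((1 + (-1) ^ k) *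
      ∫ x in Set.Ici (0 : ℝ), x ^ k ∂gaussianReal 0 1) := by
  have hmap : (gaussianReal 0 1).map (fun x : ℝ => √v * x) = gaussianReal 0 v := by
    rw [gaussianReal_map_const_mul]
    congr 1
    · simp
    · ext; simp
  rw [← hmap, integral_map (by fun_prop) (by fun_prop), ← integral_pow_gaussianReal_eq_Ici,
    ← integral_const_mul]
  simp_rw [mul_pow]

/-- Moments of a centred Gaussian variable `T` on the half space `V ≥ 0`. -/
theorem integral_pow_restrict_nonneg {S : Type*} [MeasurableSpace S] {P : Measure S}
    {T V : S → ℝ} (hTV : HasGaussianLaw (fun s => (T s, V s)) P) (hVm : Measurable V)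
    (hT : ∫ s, T s ∂P = 0) (hV : ∫ s, V s ∂P = 0) (hVV : Var[V; P] = 1) {d Q : ℝ}
    (hd : cov[T, V; P] = d) (hQ : Var[T; P] = Q) :
    (∫ s in {s | 0 ≤ V s}, T s ∂P = (√(2 * Real.pi))⁻¹ * d) ∧
    (∫ s in {s | 0 ≤ V s}, T s ^ 2 ∂P = Q / 2) ∧
    (∫ s in {s | 0 ≤ V s}, T s ^ 3 ∂P = (√(2 * Real.pi))⁻¹ * (3 * d * Q - d ^ 3)) ∧
    (∫ s in {s | 0 ≤ V s}, T s ^ 4 ∂P = 3 * Q ^ 2 / 2) := by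
  have hP := hTV.isProbabilityMeasure
  have hT2 := hTV.fst.memLp_two
  have hV2 := hTV.snd.memLp_two
  -- The residual of the regression of `T` on `V`. As `V` has variance one, `N` is uncorrelated with
  -- `V`, hence independent of it by joint Gaussianity.
  set N : S → ℝ := fun s => T s - d * V s with hN
  have hNV : HasGaussianLaw (fun s => (N s, V s)) P :=
    hTV.map_fun ((ContinuousLinearMap.fst ℝ ℝ ℝ - d • ContinuousLinearMap.snd ℝ ℝ ℝ).prod
      (ContinuousLinearMap.snd ℝ ℝ ℝ))
  have hdV2 : MemLp (fun s => d * V s) 2 P := hV2.const_mul d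
  have hVV' : cov[V, V; P] = 1 := by rw [covariance_self hV2.aestronglyMeasurable.aemeasurable, hVV]
  have hcov : cov[N, V; P] = 0 := by
    rw [hN, covariance_fun_sub_left hT2 hdV2 hV2, covariance_const_mul_left, hd, hVV']
    ring
  have hind : IndepFun N V P := hNV.indepFun_of_covariance_eq_zero hcov
  have hNvar : Var[N; P] = Q - d ^ 2 := by
    rw [← covariance_self hNV.fst.aemeasurable, hN, covariance_fun_sub_fun_sub hT2 hdV2 hT2 hdV2,
      covariance_const_mul_right, covariance_const_mul_left, covariance_const_mul_left,
      covariance_const_mul_right, hVV', covariance_comm V T, hd,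
      covariance_self hTV.fst.aemeasurable, hQ]
    ring
  have hNmean : ∫ s, N s ∂P = 0 := by
    rw [hN, integral_sub hTV.fst.integrable (hTV.snd.integrable.const_mul d), integral_const_mul,
      hT, hV]
    ring
  have hVlaw : P.map V = gaussianReal 0 1 := by
    rw [hTV.snd.map_eq_gaussianReal, hV, hVV, Real.toNNReal_one]
  have hNlaw : P.map N = gaussianReal 0 (Q - d ^ 2).toNNReal := by
    rw [hNV.fst.map_eq_gaussianReal, hNmean, hNvar]
  have hs2 : 0 ≤ Q - d ^ 2 := hNvar ▸ variance_nonneg N P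
  have hNmom : ∀ k, ∫ s, N s ^ k ∂P = √(Q - d ^ 2) ^ k * ((1 + (-1) ^ k) *
      ∫ x in Set.Ici (0 : ℝ), x ^ k ∂gaussianReal 0 1) := by
    intro k
    have := integral_map hNV.fst.aemeasurable (f := fun x : ℝ => x ^ k) (by fun_prop)
    rw [← this, hNlaw, integral_pow_gaussianReal, Real.coe_toNNReal _ hs2]
  have hNint : ∀ k, Integrable (fun s => N s ^ k) P := fun k => by
    have := (hNlaw ▸ gaussianReal_integrable_pow k _ : Integrable (fun x : ℝ => x ^ k) (P.map N))
    exact this.comp_aemeasurable hNV.fst.aemeasurable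
  have hsetm : MeasurableSet {s | 0 ≤ V s} := measurableSet_le measurable_const hVm
  -- The event `V ≥ 0` concerns `V` alone, so its indicator can be merged into the power of `V` and
  -- the mixed moments factor.
  have hmix : ∀ j k, Integrable (fun s => V s ^ j * N s ^ k) (P.restrict {s | 0 ≤ V s}) ∧
      ∫ s in {s | 0 ≤ V s}, V s ^ j * N s ^ k ∂P
        = (∫ x in Set.Ici (0 : ℝ), x ^ j ∂gaussianReal 0 1) * ∫ s, N s ^ k ∂P := by
    intro j k
    set u : ℝ → ℝ := (Set.Ici (0 : ℝ)).indicator (fun x => x ^ j) with hu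
    have hum : Measurable u := (measurable_id.pow_const j).indicator measurableSet_Ici
    have hi : IndepFun (fun s => u (V s)) (fun s => N s ^ k) P :=
      hind.symm.comp hum (measurable_id.pow_const k)
    have hui : Integrable (fun s => u (V s)) P := by
      have : Integrable u (P.map V) := by
        rw [hVlaw]; exact (gaussianReal_integrable_pow j 1).indicator measurableSet_Ici
      exact this.comp_aemeasurable hVm.aemeasurable
    have heq : (fun s => u (V s) * N s ^ k)
        = {s | 0 ≤ V s}.indicator (fun s => V s ^ j * N s ^ k) := by
      funext s
      by_cases h : 0 ≤ V s <;> simp [hu, Set.indicator, h]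
    constructor
    · rw [← IntegrableOn, ← integrable_indicator_iff hsetm, ← heq]
      exact hi.integrable_mul hui (hNint k)
    · rw [← integral_indicator hsetm, ← heq, hi.integral_fun_mul_eq_mul_integral
        hui.aestronglyMeasurable (hNint k).aestronglyMeasurable,
        ← integral_map hVm.aemeasurable hum.aestronglyMeasurable, hVlaw, hu,
        integral_indicator measurableSet_Ici]
  have hTs : ∀ s, T s = d * V s + N s := fun s => by simp only [hN]; ring
  have hs4 : √(Q - d ^ 2) ^ 2 = Q - d ^ 2 := Real.sq_sqrt hs2
  have N0 : ∫ s, N s ^ 0 ∂P = 1 := by simp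
  have N1 : ∫ s, N s ^ 1 ∂P = 0 := by rw [hNmom]; norm_num
  have N2 : ∫ s, N s ^ 2 ∂P = Q - d ^ 2 := by
    rw [hNmom, hs4, integral_Ici_gaussianReal_two]; norm_num
  have N3 : ∫ s, N s ^ 3 ∂P = 0 := by rw [hNmom]; norm_num
  have N4 : ∫ s, N s ^ 4 ∂P = 3 * (Q - d ^ 2) ^ 2 := by
    rw [hNmom, integral_Ici_gaussianReal_four, show 4 = 2 * 2 from rfl, pow_mul, hs4]
    norm_num
    ring
  have I := fun j k => (hmix j k).1
  have E := fun j k => (hmix j k).2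
  -- Binomial expansion of `(d V + N) ^ k`; only the terms with an even power of `N` will survive.
  have hsum : ∀ k, ∫ s in {s | 0 ≤ V s}, T s ^ k ∂P = ∑ m ∈ Finset.range (k + 1),
      d ^ m * (k.choose m : ℝ) * ((∫ x in Set.Ici (0 : ℝ), x ^ m ∂gaussianReal 0 1)
        * ∫ s, N s ^ (k - m) ∂P) := by
    intro k
    have e : ∀ s, T s ^ k = ∑ m ∈ Finset.range (k + 1),
        d ^ m * (k.choose m : ℝ) * (V s ^ m * N s ^ (k - m)) := fun s => by
      rw [hTs, add_pow]
      exact Finset.sum_congr rfl fun m _ => by rw [mul_pow]; ring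
    simp_rw [e]
    rw [integral_finsetSum _ fun m _ => (I m (k - m)).const_mul _]
    simp_rw [integral_const_mul, E]
  refine ⟨?_, ?_, ?_, ?_⟩
  · have h := hsum 1
    simp only [Finset.sum_range_succ, Finset.sum_range_zero, Nat.sub_self, Nat.sub_zero,
      N0, N1, integral_Ici_gaussianReal_one, mul_zero, zero_add, mul_one, Nat.choose_self,
      Nat.cast_one] at h
    simpa only [pow_one, mul_comm] using h
  · rw [hsum 2]
    simp only [Finset.sum_range_succ, Finset.sum_range_zero, Nat.sub_self, Nat.sub_zero,
      show 2 - 1 = 1 from rfl, N0, N1, N2, integral_Ici_gaussianReal_zero,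
      integral_Ici_gaussianReal_two]
    norm_num
    ring
  · rw [hsum 3]
    simp only [Finset.sum_range_succ, Finset.sum_range_zero, Nat.sub_self, Nat.sub_zero,
      show 3 - 1 = 2 from rfl, show 3 - 2 = 1 from rfl, N0, N1, N2, N3,
      integral_Ici_gaussianReal_one, integral_Ici_gaussianReal_three, Nat.choose_one_right]
    norm_num
    ring
  · rw [hsum 4]
    simp only [Finset.sum_range_succ, Finset.sum_range_zero, Nat.sub_self, Nat.sub_zero,
      show 4 - 1 = 3 from rfl, show 4 - 2 = 2 from rfl, show 4 - 3 = 1 from rfl, N0, N1, N2, N3,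
      N4, integral_Ici_gaussianReal_zero, integral_Ici_gaussianReal_two,
      integral_Ici_gaussianReal_four, show Nat.choose 4 2 = 6 from rfl]
    norm_num
    ring

/-! ### Linear forms in independent standard normal variables. -/

theorem hasGaussianLaw_id_stdNormal (n : ℕ) :
    HasGaussianLaw (fun z : Fin n → ℝ => z) (stdNormal n) := by
  refine iIndepFun.hasGaussianLaw (X := fun i (z : Fin n → ℝ) => z i) (fun i => ?_) ?_
  · exact (measurePreserving_eval (fun _ => gaussianReal 0 1) i).hasLaw.hasGaussianLaw
  · exact iIndepFun_pi (X := fun _ x => x) fun i => aemeasurable_id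

theorem covariance_eval_stdNormal {n : ℕ} (i j : Fin n) :
    cov[fun z => z i, fun z => z j; stdNormal n] = if i = j then 1 else 0 := by
  have hG := hasGaussianLaw_id_stdNormal n
  split_ifs with h
  · subst h
    rw [covariance_self (measurable_pi_apply i).aemeasurable]
    have hp : MeasurePreserving (Function.eval i) (stdNormal n) (gaussianReal 0 1) :=
      measurePreserving_eval (fun _ => gaussianReal 0 1) i
    have := hp.hasLaw.variance_eq
    rw [variance_id_gaussianReal] at this
    simpa using this
  · have hi : iIndepFun (fun i (z : Fin n → ℝ) => z i) (stdNormal n) :=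
      iIndepFun_pi (X := fun _ x => x) fun i => aemeasurable_id
    exact (hi.indepFun h).covariance_eq_zero (hG.eval i).memLp_two (hG.eval j).memLp_two

theorem covariance_dotProduct_stdNormal {n : ℕ} (b c : Fin n → ℝ) :
    cov[fun z => b ⬝ᵥ z, fun z => c ⬝ᵥ z; stdNormal n] = b ⬝ᵥ c := by
  have hG := hasGaussianLaw_id_stdNormal n
  simp only [dotProduct]
  rw [covariance_fun_sum_fun_sum (fun i => (hG.eval i).memLp_two.const_mul _)
    (fun i => (hG.eval i).memLp_two.const_mul _)]
  simp [covariance_const_mul_left, covariance_const_mul_right, covariance_eval_stdNormal, mul_comm]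

theorem integral_dotProduct_stdNormal {n : ℕ} (b : Fin n → ℝ) :
    ∫ z, b ⬝ᵥ z ∂stdNormal n = 0 := by
  have hG := hasGaussianLaw_id_stdNormal n
  simp only [dotProduct]
  rw [integral_finsetSum _ fun i _ => (hG.eval i).integrable.const_mul _]
  refine Finset.sum_eq_zero fun i _ => ?_
  have hp : MeasurePreserving (Function.eval i) (stdNormal n) (gaussianReal 0 1) :=
    measurePreserving_eval (fun _ => gaussianReal 0 1) i
  have := hp.hasLaw.integral_eq
  rw [integral_id_gaussianReal] at this
  rw [integral_const_mul]
  simp only [Function.eval] at this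
  rw [this, mul_zero]

/-- The law of `n + 1` independent standard normal variables, the last one split off. -/
noncomputable def stdNormalProd (n : ℕ) : Measure ((Fin n → ℝ) × ℝ) :=
  (stdNormal n).prod (gaussianReal 0 1)

instance (n : ℕ) : IsProbabilityMeasure (stdNormalProd n) := by
  unfold stdNormalProd; infer_instance

theorem hasGaussianLaw_id_stdNormalProd (n : ℕ) :
    HasGaussianLaw (fun p : (Fin n → ℝ) × ℝ => (p.1, p.2)) (stdNormalProd n) := by
  have h1 : HasLaw (fun p : (Fin n → ℝ) × ℝ => p.1) (stdNormal n) (stdNormalProd n) :=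
    (measurePreserving_fst (μ := stdNormal n) (ν := gaussianReal 0 1)).hasLaw
  have h2 : HasLaw (fun p : (Fin n → ℝ) × ℝ => p.2) (gaussianReal 0 1) (stdNormalProd n) :=
    (measurePreserving_snd (μ := stdNormal n) (ν := gaussianReal 0 1)).hasLaw
  have hg := (hasGaussianLaw_id_stdNormal n).isGaussian_map
  rw [Measure.map_id'] at hg
  exact IndepFun.hasGaussianLaw h1.hasGaussianLaw h2.hasGaussianLaw
    (indepFun_prod (X := fun z => z) (Y := fun w => w) (by fun_prop) (by fun_prop))

theorem covariance_stdNormalProd {n : ℕ} (b c : Fin n → ℝ) (e f : ℝ) :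
    cov[fun p => b ⬝ᵥ p.1 + e * p.2, fun p => c ⬝ᵥ p.1 + f * p.2; stdNormalProd n]
      = b ⬝ᵥ c + e * f := by
  have hG := hasGaussianLaw_id_stdNormalProd n
  have h1 : HasLaw (fun p : (Fin n → ℝ) × ℝ => p.1) (stdNormal n) (stdNormalProd n) :=
    (measurePreserving_fst (μ := stdNormal n) (ν := gaussianReal 0 1)).hasLaw
  have h2 : HasLaw (fun p : (Fin n → ℝ) × ℝ => p.2) (gaussianReal 0 1) (stdNormalProd n) :=
    (measurePreserving_snd (μ := stdNormal n) (ν := gaussianReal 0 1)).hasLaw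
  have hm : ∀ b : Fin n → ℝ, MemLp (fun z => b ⬝ᵥ z) 2 (stdNormal n) := fun b => by
    simp only [dotProduct]
    exact memLp_finsetSum _ fun i _ =>
      ((hasGaussianLaw_id_stdNormal n).eval i).memLp_two.const_mul _
  have hm1 : ∀ b : Fin n → ℝ, MemLp (fun p : (Fin n → ℝ) × ℝ => b ⬝ᵥ p.1) 2 (stdNormalProd n) :=
    fun b => (hm b).comp_measurePreserving measurePreserving_fst
  have hw : ∀ e : ℝ, MemLp (fun w : ℝ => e * w) 2 (gaussianReal 0 1) := fun e =>
    (memLp_id_gaussianReal' 2 (by simp)).const_mul e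
  have hm2 : ∀ e : ℝ, MemLp (fun p : (Fin n → ℝ) × ℝ => e * p.2) 2 (stdNormalProd n) := fun e =>
    hG.snd.memLp_two.const_mul e
  have c11 : cov[fun p => b ⬝ᵥ p.1, fun p => c ⬝ᵥ p.1; stdNormalProd n] = b ⬝ᵥ c := by
    have := h1.covariance_fun_comp (f := fun z => b ⬝ᵥ z) (g := fun z => c ⬝ᵥ z)
      (by fun_prop) (by fun_prop)
    rw [this, covariance_dotProduct_stdNormal]
  have c22 : cov[fun p => e * p.2, fun p => f * p.2; stdNormalProd n] = e * f := by
    rw [covariance_const_mul_left, covariance_const_mul_right, covariance_self (by fun_prop),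
      h2.variance_eq, variance_id_gaussianReal]
    simp
  have c12 : ∀ (b : Fin n → ℝ) (f : ℝ),
      cov[fun p => b ⬝ᵥ p.1, fun p => f * p.2; stdNormalProd n] = 0 := fun b f =>
    covariance_fst_snd_prod (hm b) (hw f)
  rw [← Pi.add_def (fun p : (Fin n → ℝ) × ℝ => b ⬝ᵥ p.1) (fun p => e * p.2), ←
    Pi.add_def (fun p : (Fin n → ℝ) × ℝ => c ⬝ᵥ p.1) (fun p => f * p.2),
    covariance_add_left (hm1 b) (hm2 e) ((hm1 c).add (hm2 f)),
    covariance_add_right (hm1 b) (hm1 c) (hm2 f), covariance_add_right (hm2 e) (hm1 c) (hm2 f),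
    c11, c22, c12, covariance_comm, c12]
  ring

theorem integral_stdNormalProd {n : ℕ} (b : Fin n → ℝ) (e : ℝ) :
    ∫ p, (b ⬝ᵥ p.1 + e * p.2) ∂stdNormalProd n = 0 := by
  have hG := hasGaussianLaw_id_stdNormalProd n
  have h1 : HasLaw (fun p : (Fin n → ℝ) × ℝ => p.1) (stdNormal n) (stdNormalProd n) :=
    (measurePreserving_fst (μ := stdNormal n) (ν := gaussianReal 0 1)).hasLaw
  have h2 : HasLaw (fun p : (Fin n → ℝ) × ℝ => p.2) (gaussianReal 0 1) (stdNormalProd n) :=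
    (measurePreserving_snd (μ := stdNormal n) (ν := gaussianReal 0 1)).hasLaw
  have hi : Integrable (fun p : (Fin n → ℝ) × ℝ => b ⬝ᵥ p.1) (stdNormalProd n) := by
    simp only [dotProduct]
    exact integrable_finsetSum _ fun i _ => (hG.fst.eval i).integrable.const_mul _
  have e1 := h1.integral_comp (f := fun z => b ⬝ᵥ z) (by fun_prop)
  have e2 := h2.integral_eq
  rw [integral_id_gaussianReal] at e2
  rw [integral_add hi (hG.snd.integrable.const_mul e), integral_const_mul, e2]
  rw [integral_dotProduct_stdNormal] at e1
  rw [mul_zero, add_zero, ← e1]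
  rfl

theorem hasGaussianLaw_linear_stdNormalProd {n : ℕ} (b c : Fin n → ℝ) (e f : ℝ) :
    HasGaussianLaw (fun p : (Fin n → ℝ) × ℝ => (b ⬝ᵥ p.1 + e * p.2, c ⬝ᵥ p.1 + f * p.2))
      (stdNormalProd n) := by
  let ℓ : (Fin n → ℝ) → ℝ → ((Fin n → ℝ) × ℝ →L[ℝ] ℝ) := fun b e =>
    LinearMap.toContinuousLinearMap
      { toFun := fun p => b ⬝ᵥ p.1 + e * p.2
        map_add' := fun p q => by simp [dotProduct_add]; ring
        map_smul' := fun r p => by simp [dotProduct_smul]; ring }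
  exact (hasGaussianLaw_id_stdNormalProd n).map_fun ((ℓ b e).prod (ℓ c f))

/-! ### Moments of linear functionals of a skew-normal vector. -/

/-- The moments of linear functionals of a skew-normal vector. -/
theorem skewNormal_moments {n : ℕ} (hn : 1 ≤ n) {Om : Matrix (Fin n) (Fin n) ℝ} (hOm : Om.PosDef)
    {α w a : Fin n → ℝ} (ha : a = (scaleMat Om)⁻¹ *ᵥ α)
    (hw : Om *ᵥ a = √(1 + a ⬝ᵥ Om *ᵥ a) • w) (t : Fin n → ℝ) :
    (∀ k : ℕ, Integrable (fun x => (t ⬝ᵥ x) ^ k) (skewNormal 0 Om α)) ∧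
    (∫ x, t ⬝ᵥ x ∂skewNormal 0 Om α = √(2 / Real.pi) * (t ⬝ᵥ w)) ∧
    (∫ x, (t ⬝ᵥ x) ^ 2 ∂skewNormal 0 Om α = t ⬝ᵥ Om *ᵥ t) ∧
    (∫ x, (t ⬝ᵥ x) ^ 3 ∂skewNormal 0 Om α
      = √(2 / Real.pi) * (3 * (t ⬝ᵥ w) * (t ⬝ᵥ Om *ᵥ t) - (t ⬝ᵥ w) ^ 3)) ∧
    (∫ x, (t ⬝ᵥ x) ^ 4 ∂skewNormal 0 Om α = 3 * (t ⬝ᵥ Om *ᵥ t) ^ 2) := by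
  obtain ⟨S, hS, hSOm⟩ := exists_mul_transpose_eq hOm
  -- The variance of `a'Sz - w`, with `w` here the extra normal coordinate; dividing by `√κ` makes
  -- the conditioning variable `V` standard without changing the event.
  set κ := 1 + a ⬝ᵥ Om *ᵥ a with hκ
  have hκ0 : 0 < κ := by
    have := hOm.posSemidef.dotProduct_mulVec_nonneg a
    simp only [star_trivial] at this
    linarith
  have hsκ : √κ ^ 2 = κ := Real.sq_sqrt hκ0.le
  have hsκ0 : √κ ≠ 0 := (Real.sqrt_pos.mpr hκ0).ne'
  have hlin : ∀ x z : Fin n → ℝ, x ⬝ᵥ S *ᵥ z = (Sᵀ *ᵥ x) ⬝ᵥ z := fun x z => by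
    rw [Matrix.dotProduct_mulVec, ← Matrix.mulVec_transpose]
  have hquad : ∀ x y : Fin n → ℝ, (Sᵀ *ᵥ x) ⬝ᵥ (Sᵀ *ᵥ y) = x ⬝ᵥ Om *ᵥ y := fun x y => by
    rw [← hlin, Matrix.mulVec_mulVec, hSOm]
  have hωT : (scaleMat Om)⁻¹ᵀ = (scaleMat Om)⁻¹ := by
    rw [Matrix.transpose_nonsing_inv, scaleMat, Matrix.diagonal_transpose]
  set V : (Fin n → ℝ) × ℝ → ℝ := fun p => ((√κ)⁻¹ • Sᵀ *ᵥ a) ⬝ᵥ p.1 + (-(√κ)⁻¹) * p.2 with hV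
  have hset : {p : (Fin n → ℝ) × ℝ | p.2 ≤ α ⬝ᵥ ((scaleMat (S * Sᵀ))⁻¹ *ᵥ (S *ᵥ p.1))}
      = {p | 0 ≤ V p} := by
    ext p
    have h1 : α ⬝ᵥ ((scaleMat (S * Sᵀ))⁻¹ *ᵥ (S *ᵥ p.1)) = (Sᵀ *ᵥ a) ⬝ᵥ p.1 := by
      rw [hSOm, Matrix.dotProduct_mulVec, ← Matrix.mulVec_transpose, hωT, ← ha, hlin]
    have h2 : V p = (√κ)⁻¹ * ((Sᵀ *ᵥ a) ⬝ᵥ p.1 - p.2) := by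
      simp only [hV, smul_dotProduct, smul_eq_mul]; ring
    rw [Set.mem_ofPred_eq, Set.mem_ofPred_eq, h1, h2,
      mul_nonneg_iff_of_pos_left (inv_pos.mpr (Real.sqrt_pos.mpr hκ0)), sub_nonneg]
  set T : (Fin n → ℝ) × ℝ → ℝ := fun p => (Sᵀ *ᵥ t) ⬝ᵥ p.1 + 0 * p.2 with hT
  have hTV : HasGaussianLaw (fun p => (T p, V p)) (stdNormalProd n) :=
    hasGaussianLaw_linear_stdNormalProd _ _ _ _
  have hVm : Measurable V := by simp only [hV, dotProduct]; fun_prop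
  have hlaw := skewNormal_eq_map hn α hS
  rw [hset, hSOm, ← stdNormalProd] at hlaw
  have hSm : Measurable fun p : (Fin n → ℝ) × ℝ => S *ᵥ p.1 :=
    (by fun_prop : Measurable fun z : Fin n → ℝ => S *ᵥ z).comp measurable_fst
  have hTS : ∀ p : (Fin n → ℝ) × ℝ, t ⬝ᵥ S *ᵥ p.1 = T p := fun p => by
    simp only [hT, hlin, zero_mul, add_zero]
  have hI : ∀ k : ℕ, ∫ x, (t ⬝ᵥ x) ^ k ∂skewNormal 0 Om α
      = 2 * ∫ p in {p | 0 ≤ V p}, T p ^ k ∂stdNormalProd n := fun k => by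
    rw [hlaw, integral_smul_measure, integral_map hSm.aemeasurable (by fun_prop)]
    simp [hTS]
  have hVV : Var[V; stdNormalProd n] = 1 := by
    rw [← covariance_self hVm.aemeasurable, hV, covariance_stdNormalProd]
    simp only [smul_dotProduct, dotProduct_smul, hquad, smul_eq_mul]
    have : a ⬝ᵥ Om *ᵥ a = κ - 1 := by rw [hκ]; ring
    rw [this]
    field_simp
    rw [hsκ]; ring
  -- The covariance is `(√κ)⁻¹ t'Ωa`, and `hw` says that `Ωa` is `√κ` times `w`.
  have hd : cov[T, V; stdNormalProd n] = t ⬝ᵥ w := by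
    rw [hT, hV, covariance_stdNormalProd]
    simp only [dotProduct_smul, hquad, smul_eq_mul, hw]
    field_simp
    ring
  have hQ : Var[T; stdNormalProd n] = t ⬝ᵥ Om *ᵥ t := by
    rw [← covariance_self hTV.fst.aemeasurable, hT, covariance_stdNormalProd, hquad]
    ring
  obtain ⟨m1, m2, m3, m4⟩ := integral_pow_restrict_nonneg hTV hVm (integral_stdNormalProd _ _)
    (integral_stdNormalProd _ _) hVV hd hQ
  -- The factor 2 is the reciprocal of the probability of the half-space.
  have hc : √(2 / Real.pi) = 2 * (√(2 * Real.pi))⁻¹ := by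
    rw [Real.sqrt_div (by norm_num), Real.sqrt_mul (by norm_num)]
    have := Real.mul_self_sqrt (show (0 : ℝ) ≤ 2 by norm_num)
    field_simp
    linarith
  refine ⟨fun k => ?_, ?_, ?_, ?_, ?_⟩
  · rw [hlaw]
    refine Integrable.smul_measure ?_ (by simp)
    rw [integrable_map_measure (by fun_prop) hSm.aemeasurable]
    refine Integrable.restrict ?_
    have := (hTV.fst.memLp (p := k) (by simp)).integrable_norm_pow'
    refine this.mono (by simp only [Function.comp_def, hTS]; fun_prop) (by simp [hTS])
  · have := hI 1
    simp only [pow_one] at this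
    rw [this, m1, hc]; ring
  · rw [hI, m2]; ring
  · rw [hI, m3, hc]; ring
  · rw [hI, m4]; ring

/-- In terms of the additive parameters, `δ_w` is proportional to `Ω ω⁻¹ α`. -/
theorem IsAdditiveParam.mulVec_eq {n : ℕ} {Om Psi : Matrix (Fin n) (Fin n) ℝ} (hOm : Om.PosDef)
    {α δ : Fin n → ℝ} (h : IsAdditiveParam Om α δ Psi) :
    Om *ᵥ ((scaleMat Om)⁻¹ *ᵥ α) =
      √(1 + ((scaleMat Om)⁻¹ *ᵥ α) ⬝ᵥ Om *ᵥ ((scaleMat Om)⁻¹ *ᵥ α)) • scaledDelta Om δ := by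
  set W := scaleMat Om with hW
  set D := deltaMat δ with hD
  set l := D⁻¹ *ᵥ δ with hl
  set κ := 1 + l ⬝ᵥ Psi⁻¹ *ᵥ l with hκ
  have hκ0 : 0 < κ := by
    have := h.posDef.inv.posSemidef.dotProduct_mulVec_nonneg l
    simp only [star_trivial] at this
    linarith
  have hWu : IsUnit W.det := by
    rw [hW, scaleMat, Matrix.det_diagonal, isUnit_iff_ne_zero, Finset.prod_ne_zero_iff]
    exact fun i _ => (Real.sqrt_pos.mpr hOm.diag_pos).ne'
  have hDu : IsUnit D.det := by
    rw [hD, deltaMat, Matrix.det_diagonal, isUnit_iff_ne_zero, Finset.prod_ne_zero_iff]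
    refine fun i _ => (Real.sqrt_pos.mpr ?_).ne'
    have := h.mem i
    nlinarith [this.1, this.2]
  have hPu : IsUnit Psi.det := h.posDef.det_pos.ne'.isUnit
  have hcorr : Om * W⁻¹ = W * (D * (Psi + Matrix.vecMulVec l l) * D) := by
    rw [← h.corr, ← Matrix.mul_assoc, ← Matrix.mul_assoc, Matrix.mul_nonsing_inv _ hWu,
      Matrix.one_mul]
  have hκs : (√κ)⁻¹ * κ = √κ := by
    have := Real.mul_self_sqrt hκ0.le
    have h0 := (Real.sqrt_pos.mpr hκ0).ne'
    field_simp
    linarith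
  have hα : α = (√κ)⁻¹ • (D⁻¹ *ᵥ (Psi⁻¹ *ᵥ l)) := h.shape
  have key : Om *ᵥ (W⁻¹ *ᵥ α) = √κ • scaledDelta Om δ := by
    rw [Matrix.mulVec_mulVec, hcorr, hα, Matrix.mulVec_smul, ← Matrix.mulVec_mulVec,
      ← Matrix.mulVec_mulVec, Matrix.mulVec_mulVec _ D, Matrix.mul_nonsing_inv _ hDu,
      Matrix.one_mulVec, ← Matrix.mulVec_mulVec, Matrix.add_mulVec, Matrix.mulVec_mulVec _ Psi,
      Matrix.mul_nonsing_inv _ hPu, Matrix.one_mulVec]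
    -- The rank-one update `(Ψ + λλ')Ψ⁻¹` has `λ` as an eigenvector with eigenvalue `κ = 1 +
    -- λ'Ψ⁻¹λ`.
    have : l + Matrix.vecMulVec l l *ᵥ (Psi⁻¹ *ᵥ l) = κ • l := by
      rw [Matrix.vecMulVec_mulVec, hκ, add_smul, one_smul]
      simp
    rw [this, Matrix.mulVec_smul, Matrix.mulVec_smul, smul_smul, hκs, hl, Matrix.mulVec_mulVec _ D,
      Matrix.mul_nonsing_inv _ hDu, Matrix.one_mulVec, scaledDelta]
  -- The two normalizations agree: by `key` the quadratic form equals `√κ α'δ`, which is `λ'Ψ⁻¹λ`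
  -- because `δ = Δλ`.
  have hq : 1 + (W⁻¹ *ᵥ α) ⬝ᵥ Om *ᵥ (W⁻¹ *ᵥ α) = κ := by
    have hWT : Wᵀ = W := by rw [hW, scaleMat, Matrix.diagonal_transpose]
    have hDT : (D⁻¹)ᵀ = D⁻¹ := by
      rw [Matrix.transpose_nonsing_inv, hD, deltaMat, Matrix.diagonal_transpose]
    rw [key, dotProduct_smul, scaledDelta, Matrix.dotProduct_mulVec, ← Matrix.mulVec_transpose, ← hW,
      hWT, Matrix.mulVec_mulVec, Matrix.mul_nonsing_inv _ hWu, Matrix.one_mulVec, hα,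
      smul_dotProduct, smul_smul, mul_inv_cancel₀ (Real.sqrt_pos.mpr hκ0).ne', one_smul,
      dotProduct_comm, Matrix.dotProduct_mulVec, ← Matrix.mulVec_transpose, hDT, ← hl]
  rw [hq, key]

/-! ### Calculus of means, and mixed skew-normal moments by polarization. -/

/-- `f` is integrable with mean `v`. -/
def HasMean {S : Type*} [MeasurableSpace S] (P : Measure S) (f : S → ℝ) (v : ℝ) : Prop :=
  Integrable f P ∧ ∫ s, f s ∂P = v

namespace HasMean

variable {S : Type*} [MeasurableSpace S] {P : Measure S} {f g : S → ℝ} {v w : ℝ}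

theorem add (hf : HasMean P f v) (hg : HasMean P g w) : HasMean P (fun s => f s + g s) (v + w) :=
  ⟨hf.1.add hg.1, by rw [integral_add hf.1 hg.1, hf.2, hg.2]⟩

theorem const_mul (c : ℝ) (hf : HasMean P f v) : HasMean P (fun s => c * f s) (c * v) :=
  ⟨hf.1.const_mul c, by rw [integral_const_mul, hf.2]⟩

theorem sum {ι : Type*} (t : Finset ι) {F : ι → S → ℝ} {u : ι → ℝ}
    (h : ∀ i ∈ t, HasMean P (F i) (u i)) :
    HasMean P (fun s => ∑ i ∈ t, F i s) (∑ i ∈ t, u i) :=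
  ⟨integrable_finsetSum _ fun i hi => (h i hi).1, by
    rw [integral_finsetSum _ fun i hi => (h i hi).1]
    exact Finset.sum_congr rfl fun i hi => (h i hi).2⟩

theorem const [IsProbabilityMeasure P] (c : ℝ) : HasMean P (fun _ => c) c :=
  ⟨integrable_const c, by simp⟩

theorem congr (hf : HasMean P f v) (h : ∀ s, f s = g s) (hv : v = w) : HasMean P g w := by
  obtain rfl : f = g := funext h
  exact hv ▸ hf

theorem of_identDistrib {S' : Type*} [MeasurableSpace S'] {P' : Measure S'} {g : S' → ℝ}
    (hf : HasMean P f v) (h : IdentDistrib f g P P') : HasMean P' g v :=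
  ⟨h.integrable_snd hf.1, by rw [← h.integral_eq, hf.2]⟩

end HasMean

/-- Polarization: a product of `k` coordinates is a signed sum of `k`-th powers of the linear forms
`x i ± x j ± …`, whose means `skewNormal_moments` supplies. -/
theorem hasMean_skewNormal {n : ℕ} (hn : 1 ≤ n) {Om : Matrix (Fin n) (Fin n) ℝ} (hOm : Om.PosDef)
    {α w a : Fin n → ℝ} (ha : a = (scaleMat Om)⁻¹ *ᵥ α)
    (hw : Om *ᵥ a = √(1 + a ⬝ᵥ Om *ᵥ a) • w) :
    (∀ i, HasMean (skewNormal 0 Om α) (fun x => x i) (√(2 / Real.pi) * w i)) ∧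
    (∀ i j, HasMean (skewNormal 0 Om α) (fun x => x i * x j) (Om i j)) ∧
    (∀ i j k, HasMean (skewNormal 0 Om α) (fun x => x i * x j * x k)
      (√(2 / Real.pi) * (w i * Om j k + w j * Om i k + w k * Om i j - w i * w j * w k))) ∧
    (∀ i j k l, HasMean (skewNormal 0 Om α) (fun x => x i * x j * x k * x l)
      (Om i j * Om k l + Om i k * Om j l + Om i l * Om j k)) := by
  have M := skewNormal_moments hn hOm ha hw
  have hsymm : ∀ i j, Om j i = Om i j := fun i j => by simpa using hOm.isHermitian.apply i j
  -- One family serves every order: a zero coefficient discards an index, and the index passed there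
  -- is a dummy.
  let t : Fin n → Fin n → Fin n → Fin n → ℝ → ℝ → ℝ → Fin n → ℝ := fun i j k l a b c =>
    Pi.single i 1 + a • Pi.single j 1 + b • Pi.single k 1 + c • Pi.single l 1
  have ht : ∀ i j k l a b c (x : Fin n → ℝ),
      t i j k l a b c ⬝ᵥ x = x i + a * x j + b * x k + c * x l := fun i j k l a b c x => by
    simp [t, add_dotProduct]
  have hq : ∀ i j k l a b c, t i j k l a b c ⬝ᵥ Om *ᵥ t i j k l a b c
      = Om i i + a ^ 2 * Om j j + b ^ 2 * Om k k + c ^ 2 * Om l l + 2 * a * Om i j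
        + 2 * b * Om i k + 2 * c * Om i l + 2 * a * b * Om j k + 2 * a * c * Om j l
        + 2 * b * c * Om k l := fun i j k l a b c => by
    rw [ht]
    simp only [t, Matrix.mulVec_add, Matrix.mulVec_smul, Matrix.mulVec_single_one, Pi.add_apply,
      Pi.smul_apply, Matrix.col_apply, smul_eq_mul, hsymm i j, hsymm i k, hsymm i l, hsymm j k,
      hsymm j l, hsymm k l]
    ring
  have h1 : (1 : ℝ) ≠ -1 := by norm_num
  have Q1 : ∀ t : Fin n → ℝ, HasMean (skewNormal 0 Om α) (fun x => t ⬝ᵥ x)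
      (√(2 / Real.pi) * (t ⬝ᵥ w)) := fun t => ⟨by simpa using (M t).1 1, (M t).2.1⟩
  have Q2 : ∀ t : Fin n → ℝ, HasMean (skewNormal 0 Om α) (fun x => (t ⬝ᵥ x) ^ 2)
      (t ⬝ᵥ Om *ᵥ t) := fun t => ⟨(M t).1 2, (M t).2.2.1⟩
  have Q3 : ∀ t : Fin n → ℝ, HasMean (skewNormal 0 Om α) (fun x => (t ⬝ᵥ x) ^ 3) _ :=
    fun t => ⟨(M t).1 3, (M t).2.2.2.1⟩
  have Q4 : ∀ t : Fin n → ℝ, HasMean (skewNormal 0 Om α) (fun x => (t ⬝ᵥ x) ^ 4) _ :=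
    fun t => ⟨(M t).1 4, (M t).2.2.2.2⟩
  refine ⟨fun i => ?_, fun i j => ?_, fun i j k => ?_, fun i j k l => ?_⟩
  · exact (Q1 (Pi.single i 1)).congr (fun x => by simp) (by simp)
  -- The signed sums isolate the mixed product with coefficient `2^(k-1) k!`, whence the divisors 4,
  -- 24 and 192 for `k = 2, 3, 4`.
  · refine (HasMean.sum {1, -1} fun a _ =>
      (Q2 (t i j i i a 0 0)).const_mul (a / 4)).congr (fun x => ?_) ?_
    · simp only [ht, Finset.sum_pair h1]; ring
    · simp only [hq, Finset.sum_pair h1]; ring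
  · refine (HasMean.sum {1, -1} fun a _ => HasMean.sum {1, -1} fun b _ =>
      (Q3 (t i j k i a b 0)).const_mul (a * b / 24)).congr (fun x => ?_) ?_
    · simp only [ht, Finset.sum_pair h1]; ring
    · simp only [hq]
      simp only [ht, Finset.sum_pair h1]
      ring
  · refine (HasMean.sum {1, -1} fun a _ => HasMean.sum {1, -1} fun b _ =>
      HasMean.sum {1, -1} fun c _ =>
      (Q4 (t i j k l a b c)).const_mul (a * b * c / 192)).congr (fun x => ?_) ?_
    · simp only [ht, Finset.sum_pair h1]; ring
    · simp only [hq, Finset.sum_pair h1]; ring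

/-! ### The spherical representation: radial and directional parts. -/

theorem ae_norm_eq_one_sphereUniform (m : ℕ) : ∀ᵐ u ∂sphereUniform m, ‖u‖ = 1 := by
  have hm : Measurable fun u : EuclideanSpace ℝ (Fin m) => ‖u‖ := measurable_norm
  rw [sphereUniform, ae_map_iff measurable_subtype_coe.aemeasurable
    (measurableSet_eq_fun hm measurable_const)]
  exact Filter.Eventually.of_forall fun u => by simp

theorem continuous_repM {n : ℕ} (Om : Matrix (Fin n) (Fin n) ℝ) (δ : Fin n → ℝ)
    (Psi : Matrix (Fin n) (Fin n) ℝ) : Continuous (repM Om δ Psi) := by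
  unfold repM
  fun_prop

section Representation

variable {n : ℕ} {Om Psi : Matrix (Fin n) (Fin n) ℝ} {δ : Fin n → ℝ}
  {S : Type*} [MeasurableSpace S] {P : Measure S} [IsProbabilityMeasure P]
  {U : S → EuclideanSpace ℝ (Fin (n + 1))} {R : S → ℝ}

/-- The direction lies almost surely on the compact unit sphere, where a continuous function is
bounded. -/
theorem integrable_comp_repM (hU : HasLaw U (sphereUniform (n + 1)) P) {F : (Fin n → ℝ) → ℝ}
    (hF : Continuous F) : Integrable (fun s => F (repM Om δ Psi (U s))) P := by
  have hc := hF.comp (continuous_repM Om δ Psi)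
  obtain ⟨C, hC⟩ :=
    (isCompact_sphere (0 : EuclideanSpace ℝ (Fin (n + 1))) 1).exists_bound_of_continuousOn
    hc.continuousOn
  have hae : ∀ᵐ s ∂P, ‖U s‖ = 1 := by
    refine ae_of_ae_map (p := fun u => ‖u‖ = 1) hU.aemeasurable ?_
    rw [hU.map_eq]
    exact ae_norm_eq_one_sphereUniform _
  refine Integrable.of_bound (hc.measurable.comp_aemeasurable hU.aemeasurable).aestronglyMeasurable
    C (hae.mono fun s hs => hC _ (by simpa using hs))

theorem hasMean_radial_mul (hU : HasLaw U (sphereUniform (n + 1)) P) (hRU : IndepFun R U P)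
    {F : (Fin n → ℝ) → ℝ} (hF : Continuous F) {k : ℕ} (hR : Integrable (fun s => R s ^ k) P) :
    HasMean P (fun s => R s ^ k * F (repM Om δ Psi (U s)))
      ((∫ s, R s ^ k ∂P) * ∫ s, F (repM Om δ Psi (U s)) ∂P) := by
  have hi : IndepFun (fun s => R s ^ k) (fun s => F (repM Om δ Psi (U s))) P :=
    hRU.comp (φ := fun r => r ^ k) (measurable_id.pow_const k)
      (hF.comp (continuous_repM Om δ Psi)).measurable
  have hFi := integrable_comp_repM (Om := Om) (δ := δ) (Psi := Psi) hU hF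
  exact ⟨hi.integrable_mul hR hFi,
    hi.integral_fun_mul_eq_mul_integral hR.aestronglyMeasurable hFi.aestronglyMeasurable⟩

/-- If `(R * M i) ^ 4` has a nonzero mean and `(R * M i) ^ k` is integrable, then the `k`-th moment
of `R` is finite and positive. -/
theorem integrable_radial_pow (hU : HasLaw U (sphereUniform (n + 1)) P) (hRU : IndepFun R U P)
    (hR : AEMeasurable R P) (hR0 : ∀ᵐ s ∂P, 0 ≤ R s) (i : Fin n) {v : ℝ} (hv : v ≠ 0)
    (h4 : HasMean P (fun s => (R s * repM Om δ Psi (U s) i) ^ 4) v) {k : ℕ} (hk : k ≠ 0)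
    (hi : Integrable (fun s => (R s * repM Om δ Psi (U s) i) ^ k) P) :
    Integrable (fun s => R s ^ k) P ∧ 0 < ∫ s, R s ^ k ∂P := by
  -- Neither factor can vanish almost surely. For the directional factor this lets integrability of
  -- an independent product pass to `R ^ k`; for `R` it makes the moment positive.
  have hne : ¬ ∀ᵐ s ∂P, R s * repM Om δ Psi (U s) i = 0 := fun h => by
    refine hv ?_
    rw [← h4.2]
    exact integral_eq_zero_of_ae (h.mono fun s hs => by simp [hs])
  have hF : Continuous fun x : Fin n → ℝ => x i ^ k := by fun_prop
  have hind : IndepFun (fun s => R s ^ k) (fun s => repM Om δ Psi (U s) i ^ k) P :=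
    hRU.comp (φ := fun r => r ^ k) (measurable_id.pow_const k)
      (hF.comp (continuous_repM Om δ Psi)).measurable
  have hint : Integrable (fun s => R s ^ k) P := by
    refine hind.integrable_left_of_integrable_op (· * ·) 1 one_ne_zero (by simp [enorm_mul]) ?_
      (hR.pow_const k).aestronglyMeasurable
      (integrable_comp_repM (Om := Om) (δ := δ) (Psi := Psi) hU hF).aestronglyMeasurable ?_
    · simpa only [mul_pow] using hi
    · intro h
      refine hne (h.mono fun s hs => ?_)
      have : repM Om δ Psi (U s) i = 0 := pow_eq_zero_iff hk |>.mp hs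
      rw [this, mul_zero]
  refine ⟨hint, lt_of_le_of_ne (integral_nonneg_of_ae (hR0.mono fun s hs => pow_nonneg hs k)) ?_⟩
  intro h0
  have h :=
    (integral_eq_zero_iff_of_nonneg_ae (hR0.mono fun s hs => pow_nonneg hs k) hint).mp h0.symm
  refine hne (h.mono fun s hs => ?_)
  have : R s = 0 := pow_eq_zero_iff hk |>.mp hs
  rw [this, zero_mul]

/-- Homogeneous moments of two elliptical variables with the same directional part differ by the
ratio of the radial moments. -/
theorem hasMean_homogeneous {SX : Type*} [MeasurableSpace SX] {PX : Measure SX}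
    {X : SX → Fin n → ℝ} {Ry Rx : S → ℝ} (hU : HasLaw U (sphereUniform (n + 1)) P)
    (hRyU : IndepFun Ry U P) (hRxU : IndepFun Rx U P)
    (hX : IdentDistrib X (fun s => Rx s • repM Om δ Psi (U s)) PX P) {k : ℕ}
    (hRy : Integrable (fun s => Ry s ^ k) P)
    (hRx : Integrable (fun s => Rx s ^ k) P ∧ 0 < ∫ s, Rx s ^ k ∂P)
    {F : (Fin n → ℝ) → ℝ} (hF : Continuous F) (hom : ∀ (r : ℝ) x, F (r • x) = r ^ k * F x) {v : ℝ}
    (hv : HasMean PX (fun s => F (X s)) v) :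
    HasMean P (fun s => Ry s ^ k * F (repM Om δ Psi (U s)))
      ((∫ s, Ry s ^ k ∂P) / (∫ s, Rx s ^ k ∂P) * v) := by
  refine (hasMean_radial_mul hU hRyU hF hRy).congr (fun _ => rfl) ?_
  have h1 := hv.of_identDistrib (hX.comp hF.measurable)
  have h2 := (hasMean_radial_mul (Om := Om) (δ := δ) (Psi := Psi) hU hRxU hF hRx.1).2
  -- Here the skew-normal moment determines the directional mean, which is then carried over to the
  -- radius `Ry`.
  have h3 : v = (∫ s, Rx s ^ k ∂P) * ∫ s, F (repM Om δ Psi (U s)) ∂P := by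
    rw [← h2, ← h1.2]
    simp only [Function.comp_def, hom]
  have := hRx.2.ne'
  rw [h3]
  field_simp

end Representation

/-! ### The moments of the skew-elliptical vector, entry by entry. -/

theorem kron_apply {ι κ ι' κ' τ τ' : Type*} [KronIndex ι ι' τ] [KronIndex κ κ' τ']
    (A : Matrix ι κ ℝ) (B : Matrix ι' κ' ℝ) (p : τ) (q : τ') :
    (A ⊠ B) p q = A (KronIndex.equiv.symm p : ι × ι').1 (KronIndex.equiv.symm q : κ × κ').1
      * B (KronIndex.equiv.symm p : ι × ι').2 (KronIndex.equiv.symm q : κ × κ').2 := rfl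

end SkewElliptical

theorem theorem3p5 {n : ℕ} (hn : 1 ≤ n)
    (μ α δ : Fin n → ℝ) (Om Psi : Matrix (Fin n) (Fin n) ℝ) (hOm : Om.PosDef)
    (hpar : IsAdditiveParam Om α δ Psi)
    (g : ℝ → ℝ) (hg : IsDensityGenerator (n + 1) g)
    {SY SX S : Type*} [MeasurableSpace SY] [MeasurableSpace SX] [MeasurableSpace S]
    (PY : Measure SY) [IsProbabilityMeasure PY] (PX : Measure SX) [IsProbabilityMeasure PX]
    (P : Measure S) [IsProbabilityMeasure P]
    (Y : SY → Fin n → ℝ) (hY : HasLaw Y (skewElliptical μ Om α g) PY)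
    (X : SX → Fin n → ℝ) (hX : HasLaw X (skewNormal 0 Om α) PX)
    (U : S → EuclideanSpace ℝ (Fin (n + 1))) (hU : HasLaw U (sphereUniform (n + 1)) P)
    (Ry Rx : S → ℝ) (hRy : AEMeasurable Ry P) (hRx : AEMeasurable Rx P)
    (hRy0 : ∀ᵐ s ∂P, 0 ≤ Ry s) (hRx0 : ∀ᵐ s ∂P, 0 ≤ Rx s)
    (hRyU : IndepFun Ry U P) (hRxU : IndepFun Rx U P)
    (hYrep : IdentDistrib Y (fun s => Ry s • repM Om δ Psi (U s) + μ) PY P)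
    (hXrep : IdentDistrib X (fun s => Rx s • repM Om δ Psi (U s)) PX P)
    (hRy4 : Integrable (fun s => Ry s ^ 4) P) :
    (∀ k ∈ Finset.Icc 1 4, Integrable (fun s => Ry s ^ k) P ∧ Integrable (fun s => Rx s ^ k) P ∧
      0 < ∫ s, Rx s ^ k ∂P) ∧
    (MatIntegrable PY (fun s => col (Y s)) ∧
      expMat PY (fun s => col (Y s)) =
        col μ + (√(2 / Real.pi) * ((∫ s, Ry s ∂P) / ∫ s, Rx s ∂P)) • col (scaledDelta Om δ)) ∧
    (MatIntegrable PY (fun s => col (Y s) ⊠ row (Y s)) ∧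
      expMat PY (fun s => col (Y s) ⊠ row (Y s)) =
        col μ * row μ
          + (√(2 / Real.pi) * ((∫ s, Ry s ∂P) / ∫ s, Rx s ∂P)) •
            (col μ * row (scaledDelta Om δ) + col (scaledDelta Om δ) * row μ)
          + ((∫ s, Ry s ^ 2 ∂P) / ∫ s, Rx s ^ 2 ∂P) • Om) ∧
    (MatIntegrable PY (fun s => col (Y s) ⊠ row (Y s) ⊠ col (Y s)) ∧
      expMat PY (fun s => col (Y s) ⊠ row (Y s) ⊠ col (Y s)) =
        col μ ⊠ row μ ⊠ col μ
          + (√(2 / Real.pi) * ((∫ s, Ry s ∂P) / ∫ s, Rx s ∂P)) • A₁ μ (scaledDelta Om δ)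
          + ((∫ s, Ry s ^ 2 ∂P) / ∫ s, Rx s ^ 2 ∂P) • A₂ μ Om
          + (√(2 / Real.pi) * ((∫ s, Ry s ^ 3 ∂P) / ∫ s, Rx s ^ 3 ∂P)) •
            A₃ (scaledDelta Om δ) Om) ∧
    (MatIntegrable PY (fun s => col (Y s) ⊠ row (Y s) ⊠ col (Y s) ⊠ row (Y s)) ∧
      expMat PY (fun s => col (Y s) ⊠ row (Y s) ⊠ col (Y s) ⊠ row (Y s)) =
        col μ ⊠ row μ ⊠ col μ ⊠ row μ
          + (√(2 / Real.pi) * ((∫ s, Ry s ∂P) / ∫ s, Rx s ∂P)) • B₁ μ (scaledDelta Om δ)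
          + ((∫ s, Ry s ^ 2 ∂P) / ∫ s, Rx s ^ 2 ∂P) • B₂ μ Om
          + (√(2 / Real.pi) * ((∫ s, Ry s ^ 3 ∂P) / ∫ s, Rx s ^ 3 ∂P)) •
            B₃ μ (scaledDelta Om δ) Om
          + ((∫ s, Ry s ^ 4 ∂P) / ∫ s, Rx s ^ 4 ∂P) • B₄ Om) := by
  obtain ⟨X1, X2, X3, X4⟩ := hasMean_skewNormal hn hOm rfl (hpar.mulVec_eq hOm)
  set c := √(2 / Real.pi)
  set w := scaledDelta Om δ
  have toX : ∀ {F : (Fin n → ℝ) → ℝ} {v : ℝ}, Continuous F → HasMean (skewNormal 0 Om α) F v →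
      HasMean PX (fun s => F (X s)) v := fun hF h =>
    h.of_identDistrib ((HasLaw.id.identDistrib hX).comp hF.measurable)
  have hsymm : ∀ i j, Om j i = Om i j := fun i j => by simpa using hOm.isHermitian.apply i j
  let i₀ : Fin n := ⟨0, hn⟩
  -- A single coordinate suffices: its fourth skew-normal moment is `3 Ω_{ii}²`, positive because
  -- `Ω` is positive definite.
  have hRxk : ∀ k ≠ 0, Integrable (fun s => Rx s ^ k) P ∧ 0 < ∫ s, Rx s ^ k ∂P := by
    intro k hk
    have h4 := (toX (by fun_prop) (X4 i₀ i₀ i₀ i₀)).of_identDistrib (g := fun s =>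
      (Rx s * repM Om δ Psi (U s) i₀) * (Rx s * repM Om δ Psi (U s) i₀)
        * (Rx s * repM Om δ Psi (U s) i₀) * (Rx s * repM Om δ Psi (U s) i₀))
      (hXrep.comp (u := fun x : Fin n → ℝ => x i₀ * x i₀ * x i₀ * x i₀) (by fun_prop))
    have hk' : Integrable (fun s => (Rx s * repM Om δ Psi (U s) i₀) ^ k) P := by
      have h := ((skewNormal_moments hn hOm rfl (hpar.mulVec_eq hOm)) (Pi.single i₀ 1)).1 k
      simp only [single_one_dotProduct] at h
      have hF : Continuous fun x : Fin n → ℝ => x i₀ ^ k := by fun_prop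
      exact ((toX hF ⟨h, rfl⟩).of_identDistrib (hXrep.comp hF.measurable)).1
    refine integrable_radial_pow (Om := Om) (Psi := Psi) (δ := δ) hU hRxU hRx hRx0 i₀
      (v := 3 * Om i₀ i₀ ^ 2) ?_
      (h4.congr (fun s => by ring) (by ring)) hk hk'
    have := hOm.diag_pos (i := i₀)
    positivity
  have hRyk : ∀ k ≤ 4, Integrable (fun s => Ry s ^ k) P := by
    intro k hk
    -- Domination: `r ^ k ≤ 1 + r ^ 4` for `r ≥ 0` and `k ≤ 4`.
    refine Integrable.mono' ((integrable_const 1).add hRy4)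
      (hRy.pow_const k).aestronglyMeasurable ?_
    filter_upwards [hRy0] with s hs
    rw [Real.norm_of_nonneg (pow_nonneg hs k), Pi.add_apply]
    rcases le_total (Ry s) 1 with h | h
    · have := pow_le_one₀ hs h (n := k)
      have := pow_nonneg hs 4
      linarith
    · have := pow_le_pow_right₀ h hk
      linarith
  have hom : ∀ {k : ℕ} {F : (Fin n → ℝ) → ℝ} {v : ℝ}, k ≠ 0 → k ≤ 4 → Continuous F →
      (∀ (r : ℝ) x, F (r • x) = r ^ k * F x) → HasMean (skewNormal 0 Om α) F v →
      HasMean P (fun s => Ry s ^ k * F (repM Om δ Psi (U s)))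
        ((∫ s, Ry s ^ k ∂P) / (∫ s, Rx s ^ k ∂P) * v) := fun hk hk4 hF hr h =>
    hasMean_homogeneous hU hRyU hRxU hXrep (hRyk _ hk4) (hRxk _ hk) hF hr (toX hF h)
  have K1 := fun i => hom one_ne_zero (by norm_num) (by fun_prop) (fun r x => by simp) (X1 i)
  have K2 := fun i j => hom two_ne_zero (by norm_num) (by fun_prop)
    (fun r x => by simp only [Pi.smul_apply, smul_eq_mul]; ring) (X2 i j)
  have K3 := fun i j k => hom three_ne_zero (by norm_num) (by fun_prop)
    (fun r x => by simp only [Pi.smul_apply, smul_eq_mul]; ring) (X3 i j k)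
  have K4 := fun i j k l => hom four_ne_zero le_rfl (by fun_prop)
    (fun r x => by simp only [Pi.smul_apply, smul_eq_mul]; ring) (X4 i j k l)
  simp only [pow_one] at K1
  set p₁ := (∫ s, Ry s ∂P) / ∫ s, Rx s ∂P
  set p₂ := (∫ s, Ry s ^ 2 ∂P) / ∫ s, Rx s ^ 2 ∂P
  set p₃ := (∫ s, Ry s ^ 3 ∂P) / ∫ s, Rx s ^ 3 ∂P
  set p₄ := (∫ s, Ry s ^ 4 ∂P) / ∫ s, Rx s ^ 4 ∂P
  have toY : ∀ {F : (Fin n → ℝ) → ℝ} {v : ℝ}, Continuous F →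
      HasMean P (fun s => F (Ry s • repM Om δ Psi (U s) + μ)) v →
      HasMean PY (fun s => F (Y s)) v := fun hF h =>
    h.of_identDistrib (hYrep.symm.comp hF.measurable)
  -- From here each product of coordinates of `R_y M + μ` is expanded, and every choice of factors
  -- taken from `μ` leaves a homogeneous moment given by `K1` to `K4`.
  have Y1 : ∀ i, HasMean PY (fun s => Y s i) (μ i + c * p₁ * w i) := fun i =>
    toY (F := fun x => x i) (by fun_prop) (((K1 i).add (HasMean.const (μ i))).congr
      (fun s => by simp) (by ring))
  have Y2 : ∀ i j, HasMean PY (fun s => Y s i * Y s j)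
      (μ i * μ j + c * p₁ * (μ i * w j + w i * μ j) + p₂ * Om i j) := fun i j =>
    toY (F := fun x => x i * x j) (by fun_prop) (((K2 i j).add (((K1 i).const_mul (μ j)).add
      (((K1 j).const_mul (μ i)).add (HasMean.const (μ i * μ j))))).congr
      (fun s => by simp only [Pi.add_apply, Pi.smul_apply, smul_eq_mul]; ring) (by ring))
  have Y3 : ∀ i j k, HasMean PY (fun s => Y s i * Y s j * Y s k)
      (μ i * μ j * μ k + c * p₁ * (w i * μ j * μ k + μ i * w j * μ k + μ i * μ j * w k)
        + p₂ * (Om i j * μ k + μ i * Om j k + Om i k * μ j)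
        + c * p₃ * (w i * Om j k + w j * Om i k + w k * Om i j - w i * w j * w k)) :=
    fun i j k =>
    toY (F := fun x => x i * x j * x k) (by fun_prop) (((K3 i j k).add
      (((K2 i j).const_mul (μ k)).add (((K2 i k).const_mul (μ j)).add
      (((K2 j k).const_mul (μ i)).add (((K1 i).const_mul (μ j * μ k)).add
      (((K1 j).const_mul (μ i * μ k)).add (((K1 k).const_mul (μ i * μ j)).add
      (HasMean.const (μ i * μ j * μ k))))))))).congr
      (fun s => by simp only [Pi.add_apply, Pi.smul_apply, smul_eq_mul]; ring) (by ring))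
  let m₃ : Fin n → Fin n → Fin n → ℝ := fun i j k =>
    w i * Om j k + w j * Om i k + w k * Om i j - w i * w j * w k
  have Y4 : ∀ i j k l, HasMean PY (fun s => Y s i * Y s j * Y s k * Y s l)
      (μ i * μ j * μ k * μ l + c * p₁ * (w i * μ j * μ k * μ l + μ i * w j * μ k * μ l
          + μ i * μ j * w k * μ l + μ i * μ j * μ k * w l)
        + p₂ * (Om i j * μ k * μ l + Om i k * μ j * μ l + Om i l * μ j * μ k
          + Om j k * μ i * μ l + Om j l * μ i * μ k + Om k l * μ i * μ j)
        + c * p₃ * (m₃ i j k * μ l + m₃ i j l * μ k + m₃ i k l * μ j + m₃ j k l * μ i)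
        + p₄ * (Om i j * Om k l + Om i k * Om j l + Om i l * Om j k)) :=
    fun i j k l =>
    toY (F := fun x => x i * x j * x k * x l) (by fun_prop) (((K4 i j k l).add
      (((K3 i j k).const_mul (μ l)).add (((K3 i j l).const_mul (μ k)).add
      (((K3 i k l).const_mul (μ j)).add (((K3 j k l).const_mul (μ i)).add
      (((K2 i j).const_mul (μ k * μ l)).add (((K2 i k).const_mul (μ j * μ l)).add
      (((K2 i l).const_mul (μ j * μ k)).add (((K2 j k).const_mul (μ i * μ l)).add
      (((K2 j l).const_mul (μ i * μ k)).add (((K2 k l).const_mul (μ i * μ j)).add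
      (((K1 i).const_mul (μ j * μ k * μ l)).add (((K1 j).const_mul (μ i * μ k * μ l)).add
      (((K1 k).const_mul (μ i * μ j * μ l)).add (((K1 l).const_mul (μ i * μ j * μ k)).add
      (HasMean.const (μ i * μ j * μ k * μ l))))))))))))))))).congr
      (fun s => by simp only [Pi.add_apply, Pi.smul_apply, smul_eq_mul]; ring)
      (by simp only [m₃]; ring))
  -- Column factors feed the row index and row factors the column index: the entry at row `(i, k)`
  -- and column `j`, or `(j, l)`, is `Y i * Y j * Y k`, or `Y i * Y j * Y k * Y l`.
  refine ⟨fun k hk => ?_, ⟨fun i _ => (Y1 i).1, ?_⟩, ⟨fun i j => (Y2 i j).1, ?_⟩,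
    ⟨fun p j => (Y3 p.1 j p.2).1, ?_⟩, ⟨fun p q => (Y4 p.1 q.1 p.2 q.2).1, ?_⟩⟩
  · rw [Finset.mem_Icc] at hk
    exact ⟨hRyk k hk.2, hRxk k (by omega)⟩
  · ext i u
    refine (Y1 i).2.trans ?_
    simp
  · ext i j
    refine (Y2 i j).2.trans ?_
    simp [Matrix.mul_apply, mul_add]
  · ext ⟨i, k⟩ j
    refine (Y3 i j k).2.trans ?_
    -- Since `vec` stacks columns, it produces transposed entries of `Ω`; symmetry restores their
    -- order.
    simp [Matrix.mul_apply, A₁, A₂, A₃, kron_apply, KronIndex.equiv, Matrix.vec, Matrix.one_apply,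
      hsymm i k, hsymm j k]
    ring
  · ext ⟨i, k⟩ ⟨j, l⟩
    refine (Y4 i j k l).2.trans ?_
    simp [Matrix.mul_apply, B₁, B₂, B₃, B₄, kron_apply, KronIndex.equiv, Matrix.vec, Matrix.one_apply,
      commMat, m₃, hsymm i k, hsymm j k, hsymm j l, add_mul]
    ring
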